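/- Let $b:\mathbb{R}\times[0,\infty)\to\mathbb{R}$ be bounded and continuously differentiable, let $1\le p_0<\infty$ and $u_0\in L^{p_0}(\mathbb{R})\cap L^\infty(\mathbb{R})$, and let $0<T_*\le\infty$. Let $u:\mathbb{R}\times[0,T_*)\to\mathbb{R}$ be a solution of $$u_t+(b(x,t)\,u)_x=u_{xx},\qquad u(\cdot,0)=u_0,$$ on $[0,T_*)$, in the following sense: for every $0<T<T_*$ there is $M$ with $\|u(\cdot,t)\|_{L^\infty(\mathbb{R})}\le M$ for all $0\le t\le T$; the functions $u,u_x,u_{xx},u_t$ exist and are continuous in $\mathbb{R}\times(0,T_*)$ and satisfy the equation at every point there; $u(\cdot,0)=u_0$ almost everywhere; and $u(\cdot,t)\to u_0$ in $L^1(K)$ as $t\to0^+$ for every compact $K\subset\mathbb{R}$. Put $$B(\tau)=\tfrac12\Bigl(\sup_{x\in\mathbb{R}}b(x,\tau)-\inf_{x\in\mathbb{R}}b(x,\tau)\Bigr),\qquad C_2=\Bigl(\frac{3\sqrt3}{4\pi}\Bigr)^{1/3},$$ $$\mathbb{B}(t_0;t)=\sup_{t_0\le\tau\le t}B(\tau),\qquad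 \mathbb{U}_p(t_0;t)=\sup_{t_0\le\tau\le t}\|u(\cdot,\tau)\|_{L^p(\mathbb{R})}.$$ Then, for every real $q\ge 2p_0$ and all $0\le t_0\le t<T_*$, $$\mathbb{U}_q(t_0;t)\le\max\Bigl\{\|u(\cdot,t_0)\|_{L^q(\mathbb{R})},\ \Bigl(\frac q2\,C_2^3\Bigr)^{1/q}\,\mathbb{B}(t_0;t)^{1/q}\,\mathbb{U}_{q/2}(t_0;t)\Bigr\}.$$ (Norms and suprema are taken in $[0,\infty]$, with the convention $0\cdot\infty=0$, under which the inequality is strongest.) -/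

import Mathlib

open Real Set Filter Topology MeasureTheory
open scoped ENNReal

noncomputable section

namespace AdvDiff

/-- `b` is an admissible advection field: continuously differentiable and bounded on the closed
half plane `ℝ × [0, ∞)`. The first argument is space, the second one is time. -/
structure IsAdvectionField (b : ℝ → ℝ → ℝ) : Prop where
  contDiffOn : ContDiffOn ℝ 1 (fun z : ℝ × ℝ => b z.1 z.2) {z : ℝ × ℝ | 0 ≤ z.2}
  bounded : ∃ M : ℝ, ∀ x t : ℝ, 0 ≤ t → |b x t| ≤ M

/-- The open slab `ℝ × (0, T)`, where `T` may be `∞`. -/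
def openSlab (T : EReal) : Set (ℝ × ℝ) := {z : ℝ × ℝ | 0 < z.2 ∧ (z.2 : EReal) < T}

/-- `u` is of class `C²` in space and `C¹` in time in `ℝ × (0, T)`: the functions
`u`, `uₓ`, `uₓₓ`, `uₜ` exist and are (jointly) continuous there. -/
structure IsC21 (T : EReal) (u : ℝ → ℝ → ℝ) : Prop where
  contDiff_space : ∀ t : ℝ, 0 < t → (t : EReal) < T → ContDiff ℝ 2 (fun x => u x t)
  differentiable_time : ∀ x t : ℝ, 0 < t → (t : EReal) < T →
    DifferentiableAt ℝ (fun s => u x s) t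
  continuousOn : ContinuousOn (fun z : ℝ × ℝ => u z.1 z.2) (openSlab T)
  continuousOn_x : ContinuousOn (fun z : ℝ × ℝ => deriv (fun y => u y z.2) z.1) (openSlab T)
  continuousOn_xx :
    ContinuousOn (fun z : ℝ × ℝ => iteratedDeriv 2 (fun y => u y z.2) z.1) (openSlab T)
  continuousOn_t : ContinuousOn (fun z : ℝ × ℝ => deriv (fun s => u z.1 s) z.2) (openSlab T)

/-- `u` is a solution on the time interval `[0, T)` (`T` may be `∞`) of the initial value problem
`uₜ + (b u)ₓ = uₓₓ`, `u(·,0) = u₀`. -/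
structure IsSolution (b : ℝ → ℝ → ℝ) (u₀ : ℝ → ℝ) (T : EReal) (u : ℝ → ℝ → ℝ) : Prop where
  /-- `u ∈ L^∞_loc([0, T), L^∞(ℝ))`. -/
  bounded : ∀ S : ℝ, 0 < S → (S : EReal) < T →
    ∃ M : ℝ, ∀ t ∈ Icc 0 S, ∀ᵐ x : ℝ, |u x t| ≤ M
  regular : IsC21 T u
  equation : ∀ x t : ℝ, 0 < t → (t : EReal) < T →
    deriv (fun s => u x s) t + deriv (fun y => b y t * u y t) x
      = iteratedDeriv 2 (fun y => u y t) x
  initial : ∀ᵐ x : ℝ, u x 0 = u₀ x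
  /-- `u(·,t) → u₀` in `L¹(K)` as `t → 0⁺`, for each compact `K`. -/
  tendsto_initial : ∀ K : Set ℝ, IsCompact K →
    Tendsto (fun t : ℝ => eLpNorm (fun x => u x t - u₀ x) 1 (volume.restrict K))
      (𝓝[>] 0) (𝓝 0)

/-- The half oscillation `B(t) = (sup_x b(x,t) - inf_x b(x,t)) / 2`. -/
def halfOsc (b : ℝ → ℝ → ℝ) (t : ℝ) : ℝ := (1 / 2) * ((⨆ x : ℝ, b x t) - ⨅ x : ℝ, b x t)

/-- `𝔹(t₀; t) = sup {B(τ) : t₀ ≤ τ ≤ t}`, as an extended nonnegative real. -/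
def supOsc (b : ℝ → ℝ → ℝ) (t₀ t : ℝ) : ℝ≥0∞ :=
  ⨆ τ ∈ Icc t₀ t, ENNReal.ofReal (halfOsc b τ)

/-- `‖u(·,t)‖_{L^p(ℝ)}`, for real `p`, as an extended nonnegative real. -/
def normAt (u : ℝ → ℝ → ℝ) (p t : ℝ) : ℝ≥0∞ :=
  eLpNorm (fun x => u x t) (ENNReal.ofReal p) volume

/-- `𝕌_p(t₀; t) = sup {‖u(·,τ)‖_{L^p(ℝ)} : t₀ ≤ τ ≤ t}`, as an extended nonnegative real. -/
def supNorm (u : ℝ → ℝ → ℝ) (p t₀ t : ℝ) : ℝ≥0∞ := ⨆ τ ∈ Icc t₀ t, normAt u p τ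

/-- The constant `C₂ = (3√3 / (4π))^{1/3}` of the one-dimensional Nash inequality. -/
def nashConst : ℝ := (3 * √3 / (4 * π)) ^ (1 / 3 : ℝ)

end AdvDiff

end

/-! The proof combines an energy identity with the sharp Nash inequality. Write `v = u |u|^(q/2 -
1)`, `E = ∫ v² = ∫ |u|^q`, `N = ∫ |v| = ∫ |u|^(q/2)` and `J = ∫ v_x²`. Multiplying the equation by
`q u |u|^(q-2)` and integrating gives `E' = -(4(q-1)/q) J + 2(q-1) ∫ (b - c) v v_x` for every
constant `c`, because `∫ v v_x = 0`. With `c` the midrange of `b(·,t)`, Young's inequality yields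
`E' ≤ -(2(q-1)/q) (J - (qB/2)² E)`. Nash's inequality `E³ ≤ C₂⁶ N⁴ J` makes the right side negative
as soon as `E > (q/2) C₂³ B N²`. Hence `E` cannot grow above that threshold, and taking `q`-th roots
gives the claim.

Nothing is assumed about decay of `u` or `u_x` at infinity, so the computation is carried out for `∫
|u|^q η²` with a cutoff `η` at scale `R`. The weight `η²` is the one for which this is the square
integral of `η v`, a compactly supported function to which `nash_inequality` applies. The cutoff
errors are `O(1/R)` times the mass of `|u|^q` on the support. If `N` is finite, boundedness of `u`
controls that mass, and the errors are absorbed by the strict dissipation at height `δ` above the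
threshold (`IsSolution.lintegral_le_max`). If `B = 0`, the convention `0 · ∞ = 0` demands
monotonicity of the norm even when `N = ∞`; this is `IsSolution.lintegral_le_of_halfOsc_nonpos`. -/

/-! ### The sharp one-dimensional Nash inequality. -/

theorem hasCompactSupport_of_forall_eq_zero {f g : ℝ → ℝ} (hf : HasCompactSupport f)
    (h : ∀ x, f x = 0 → g x = 0) : HasCompactSupport g :=
  hf.mono fun x hx hf => hx (h x hf)

theorem integrable_of_forall_eq_zero {f g : ℝ → ℝ} (hf : HasCompactSupport f)
    (hg : Continuous g) (h : ∀ x, f x = 0 → g x = 0) : Integrable g :=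
  hg.integrable_of_hasCompactSupport (hasCompactSupport_of_forall_eq_zero hf h)

/-- The integral is the area of a half disc of radius `m / 2`. -/
theorem integral_sqrt_mul_sub {m : ℝ} (hm : 0 < m) :
    ∫ r in (0 : ℝ)..m, √(r * (m - r)) = π * m ^ 2 / 8 := by
  have h := intervalIntegral.smul_integral_comp_mul_add (a := -1) (b := 1)
    (fun r : ℝ => √(r * (m - r))) (m / 2) (m / 2)
  have h0 : m / 2 * (-1) + m / 2 = 0 := by ring
  have h1 : m / 2 * 1 + m / 2 = m := by ring
  rw [h0, h1] at h
  rw [← h]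
  have h2 : ∀ x : ℝ, √((m / 2 * x + m / 2) * (m - (m / 2 * x + m / 2)))
      = m / 2 * √(1 - x ^ 2) := by
    intro x
    rw [show (m / 2 * x + m / 2) * (m - (m / 2 * x + m / 2)) = (m / 2) ^ 2 * (1 - x ^ 2) by ring,
      Real.sqrt_mul (by positivity), Real.sqrt_sq (by positivity)]
  simp only [h2, intervalIntegral.integral_const_mul, integral_sqrt_one_sub_sq, smul_eq_mul]
  ring

/-- A continuously differentiable function with compact support satisfies a weighted total
variation bound: it has to climb to its maximal modulus `m` and back. -/
theorem le_integral_abs_deriv_mul_sqrt {f f' : ℝ → ℝ} (hf : ∀ x, HasDerivAt f (f' x) x)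
    (hf' : Continuous f') (hs : HasCompactSupport f) {x₀ m : ℝ} (hm : 0 < m)
    (hx₀ : f x₀ = m) :
    π * m ^ 2 / 4 ≤ ∫ x, |f' x| * √(|f x| * (m - |f x|)) := by
  set g : ℝ → ℝ := fun r => √(|r| * (m - |r|)) with hg
  have hgc : Continuous g := by fun_prop
  -- `K` is a primitive of the weight, so the weighted variation on each side of `x₀` is at least `K
  -- m - K 0 = π m² / 8`.
  set K : ℝ → ℝ := fun y => ∫ r in (0 : ℝ)..y, g r with hK
  have hKd : ∀ y, HasDerivAt K (g y) y := fun y =>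
    intervalIntegral.integral_hasDerivAt_right (hgc.intervalIntegrable _ _)
      (hgc.stronglyMeasurableAtFilter _ _) hgc.continuousAt
  have hfc : Continuous f := continuous_iff_continuousAt.2 fun x => (hf x).continuousAt
  have hKf : ∀ x, HasDerivAt (K ∘ f) (g (f x) * f' x) x := fun x => (hKd (f x)).comp x (hf x)
  have hK0 : K 0 = 0 := by simp [hK]
  have hsK : HasCompactSupport (K ∘ f) := hs.comp_left hK0
  have hde : deriv (K ∘ f) = fun x => g (f x) * f' x := funext fun x => (hKf x).deriv
  have hcK : ContDiff ℝ 1 (K ∘ f) := by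
    rw [contDiff_one_iff_deriv]
    refine ⟨fun x => (hKf x).differentiableAt, ?_⟩
    rw [hde]
    exact (hgc.comp hfc).mul hf'
  have hKm : K m = π * m ^ 2 / 8 := by
    rw [← integral_sqrt_mul_sub hm]
    refine intervalIntegral.integral_congr fun r hr => ?_
    rw [uIcc_of_le hm.le] at hr
    simp only [hg, abs_of_nonneg hr.1]
  have h1 := hsK.integral_Iic_deriv_eq hcK x₀
  have h2 := hsK.integral_Ioi_deriv_eq hcK x₀
  rw [hde] at h1 h2
  simp only [Function.comp, hx₀, hKm] at h1 h2
  have hint : Integrable (fun x => |f' x| * g (f x)) := by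
    refine (hf'.abs.mul (hgc.comp hfc)).integrable_of_hasCompactSupport ?_
    exact HasCompactSupport.mul_left (hs.comp_left (by simp [hg]))
  have hab : ∀ x, |g (f x) * f' x| = |f' x| * g (f x) := fun x => by
    rw [abs_mul, abs_of_nonneg (Real.sqrt_nonneg _), mul_comm]
  have h3 : π * m ^ 2 / 8 ≤ ∫ x in Iic x₀, |f' x| * g (f x) := by
    rw [← h1]
    simp only [← hab]
    exact (le_abs_self _).trans (abs_integral_le_integral_abs)
  have h4 : π * m ^ 2 / 8 ≤ ∫ x in Ioi x₀, |f' x| * g (f x) := by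
    rw [← neg_neg (π * m ^ 2 / 8), ← h2]
    simp only [← hab]
    exact (neg_le_abs _).trans (abs_integral_le_integral_abs)
  have h5 := intervalIntegral.integral_Iic_add_Ioi (b := x₀) hint.integrableOn hint.integrableOn
  linarith

/-- The quadratic in `k` is nonnegative, so its discriminant bounds `m⁴` by a multiple of `I (m N -
E)`. The arithmetic-geometric mean inequality bounds `E³ (m N - E)` by a multiple of `(m N)⁴`. In
the product of the two bounds the unknown maximum `m` cancels. -/
theorem nash_of_forall_quadratic {N E I V m : ℝ} (hm : 0 < m) (hN : 0 ≤ N) (hE : 0 ≤ E)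
    (hI : 0 ≤ I) (hP : E ≤ m * N) (hV : π * m ^ 2 / 4 ≤ V)
    (hY : ∀ k : ℝ, 2 * k * V ≤ I + k ^ 2 * (m * N - E)) :
    E ^ 3 ≤ 27 / (16 * π ^ 2) * N ^ 4 * I := by
  have hP : 0 ≤ m * N - E := sub_nonneg.2 hP
  have hD : discrim (m * N - E) (-(π * m ^ 2 / 2)) I ≤ 0 := by
    refine discrim_le_zero fun k => ?_
    rcases le_or_gt 0 k with hk | hk
    · have := hY k
      have h6 := mul_le_mul_of_nonneg_left hV hk
      nlinarith
    · have h7 : 0 ≤ π * m ^ 2 / 2 * (-k) := mul_nonneg (by positivity) (by linarith)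
      have h8 : 0 ≤ (m * N - E) * (k * k) := mul_nonneg hP (mul_self_nonneg k)
      linarith
  have hD' : π ^ 2 * m ^ 4 ≤ 16 * I * (m * N - E) := by
    unfold discrim at hD
    nlinarith
  -- Equality holds at `E = 3 m N / 4`, whence the double factor `(3 m N - 4 E)²` of the difference.
  have hA : 256 * E ^ 3 * (m * N - E) ≤ 27 * (m * N) ^ 4 := by
    have : 0 ≤ (3 * (m * N) - 4 * E) ^ 2
        * (3 * (m * N) ^ 2 + 8 * (m * N) * E + 16 * E ^ 2) := by positivity
    nlinarith
  have h9 : 16 * m ^ 4 * (16 * π ^ 2 * E ^ 3) ≤ 16 * m ^ 4 * (27 * N ^ 4 * I) := by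
    have h10 := mul_le_mul_of_nonneg_left hD' (show 0 ≤ 256 * E ^ 3 by positivity)
    have h11 := mul_le_mul_of_nonneg_left hA (show 0 ≤ 16 * I by positivity)
    nlinarith
  have h12 := le_of_mul_le_mul_left h9 (by positivity)
  rw [div_mul_eq_mul_div, div_mul_eq_mul_div, le_div_iff₀ (by positivity)]
  linarith

/-- The quadratic inequality in `k` is the integral of `(|f'| - k √(|f| (m - |f|)))² ≥ 0`. Equality
would mean `|f'| = k √(|f| (m - |f|))`, which is solved by one period of `m (1 + cos (k x)) / 2`;
this is what dictates the weight. -/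
theorem integral_sq_pow_three_le_of_max {f f' : ℝ → ℝ} (hf : ∀ x, HasDerivAt f (f' x) x)
    (hf' : Continuous f') (hs : HasCompactSupport f) {x₀ m : ℝ} (hm : 0 < m)
    (hx₀ : f x₀ = m) (hmax : ∀ x, |f x| ≤ m) :
    (∫ x, f x ^ 2) ^ 3 ≤ 27 / (16 * π ^ 2) * (∫ x, |f x|) ^ 4 * ∫ x, f' x ^ 2 := by
  have hfc : Continuous f := continuous_iff_continuousAt.2 fun x => (hf x).continuousAt
  have hs' : HasCompactSupport f' := (funext fun x => (hf x).deriv : deriv f = f') ▸ hs.deriv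
  have hV := le_integral_abs_deriv_mul_sqrt hf hf' hs hm hx₀
  have hi1 : Integrable fun x => |f x| :=
    integrable_of_forall_eq_zero hs (by fun_prop) fun x hx => by simp [hx]
  have hi2 : Integrable fun x => f x ^ 2 :=
    integrable_of_forall_eq_zero hs (by fun_prop) fun x hx => by simp [hx]
  have hi3 : Integrable fun x => f' x ^ 2 :=
    integrable_of_forall_eq_zero hs' (by fun_prop) fun x hx => by simp [hx]
  have hi4 : Integrable fun x => |f' x| * √(|f x| * (m - |f x|)) :=
    integrable_of_forall_eq_zero hs (by fun_prop) fun x hx => by simp [hx]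
  refine nash_of_forall_quadratic (E := ∫ x, f x ^ 2) (V := ∫ x, |f' x| * √(|f x| * (m - |f x|)))
    hm (integral_nonneg fun x => abs_nonneg _) (integral_nonneg fun x => sq_nonneg _)
    (integral_nonneg fun x => sq_nonneg _) ?_ hV fun k => ?_
  · rw [← integral_const_mul]
    refine integral_mono hi2 (hi1.const_mul m) fun x => ?_
    rw [← sq_abs, sq]
    exact mul_le_mul_of_nonneg_right (hmax x) (abs_nonneg _)
  · have hi5 : Integrable fun x => k ^ 2 * (m * |f x| - f x ^ 2) :=
      ((hi1.const_mul m).sub hi2).const_mul _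
    rw [← integral_const_mul m, ← integral_sub (hi1.const_mul m) hi2, ← integral_const_mul (k ^ 2),
      ← integral_add hi3 hi5, ← integral_const_mul]
    refine integral_mono (hi4.const_mul _) (hi3.add hi5) fun x => ?_
    have hnn : 0 ≤ |f x| * (m - |f x|) :=
      mul_nonneg (abs_nonneg _) (sub_nonneg.2 (hmax x))
    have h1 := Real.sq_sqrt hnn
    have h2 := sq_nonneg (|f' x| - k * √(|f x| * (m - |f x|)))
    have h3 := sq_abs (f x)
    have h4 := sq_abs (f' x)
    have h5 : (|f' x| - k * √(|f x| * (m - |f x|))) ^ 2 = f' x ^ 2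
      - 2 * k * (|f' x| * √(|f x| * (m - |f x|))) + k ^ 2 * (m * |f x| - f x ^ 2) := by
      rw [sub_sq, mul_pow, h1, h4, ← h3]; ring
    simp only
    linarith

/-- The sharp Nash inequality in dimension one. -/
theorem nash_inequality {f f' : ℝ → ℝ} (hf : ∀ x, HasDerivAt f (f' x) x)
    (hf' : Continuous f') (hs : HasCompactSupport f) :
    (∫ x, f x ^ 2) ^ 3 ≤ 27 / (16 * π ^ 2) * (∫ x, |f x|) ^ 4 * ∫ x, f' x ^ 2 := by
  have hfc : Continuous f := continuous_iff_continuousAt.2 fun x => (hf x).continuousAt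
  obtain ⟨x₀, hx₀⟩ := hfc.abs.exists_forall_ge_of_hasCompactSupport (hs.comp_left abs_zero)
  rcases eq_or_ne (f x₀) 0 with h0 | h0
  · have : ∀ x, f x = 0 := fun x => by
      have := hx₀ x
      rw [h0, abs_zero] at this
      exact abs_nonpos_iff.1 this
    have hr : 0 ≤ ∫ x, f' x ^ 2 := integral_nonneg fun x => sq_nonneg _
    simp [this]
  rcases h0.lt_or_gt with h | h
  · have := integral_sq_pow_three_le_of_max (f := fun x => -f x) (f' := fun x => -f' x)
      (fun x => (hf x).neg) hf'.neg (hs.comp_left (g := fun y : ℝ => -y) neg_zero)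
      (x₀ := x₀) (m := |f x₀|) (abs_pos.2 h0) (abs_of_neg h).symm
      (fun x => by simpa using hx₀ x)
    simpa using this
  · exact integral_sq_pow_three_le_of_max hf hf' hs (abs_pos.2 h0) (abs_of_pos h).symm hx₀

/-! ### The localized energy estimate at a fixed time. -/

/-- The signed power `y |y|^a` is differentiable for `a ≥ 0`. -/
theorem hasDerivAt_mul_abs_rpow {a : ℝ} (ha : 0 ≤ a) (y : ℝ) :
    HasDerivAt (fun y : ℝ => y * |y| ^ a) ((a + 1) * |y| ^ a) y := by
  -- The exponent `a = 0` is separate because `0 ^ 0 = 1`, whereas the slope at the origin below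
  -- uses `|y| ^ a → 0`.
  rcases eq_or_lt_of_le ha with rfl | ha
  · simpa using hasDerivAt_id' y
  rcases eq_or_ne y 0 with rfl | hy
  · rw [hasDerivAt_iff_tendsto_slope]
    have h : Tendsto (fun y : ℝ => |y| ^ a) (𝓝[≠] 0) (𝓝 0) := by
      have : Continuous fun y : ℝ => |y| ^ a := continuous_abs.rpow_const fun _ => Or.inr ha.le
      have h := this.tendsto 0
      simp only [abs_zero, Real.zero_rpow ha.ne'] at h
      exact h.mono_left nhdsWithin_le_nhds
    simp only [abs_zero, Real.zero_rpow ha.ne', mul_zero]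
    refine h.congr' ?_
    filter_upwards [self_mem_nhdsWithin] with z hz
    have hz : z ≠ 0 := hz
    simp [slope, Real.zero_rpow ha.ne', hz]
  · have h := (hasDerivAt_id y).mul ((hasDerivAt_abs hy).rpow_const (p := a)
      (Or.inl (abs_ne_zero.2 hy)))
    refine h.congr_deriv ?_
    have h1 : |y| ^ a = |y| ^ (a - 1) * |y| := by
      rw [← Real.rpow_add_one (abs_ne_zero.2 hy)]; ring_nf
    have h2 : y * (SignType.sign y : ℝ) = |y| := by
      rcases hy.lt_or_gt with h | h <;> simp [h, abs_of_neg, abs_of_pos]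
    simp only [id, one_mul]
    rw [h1, ← h2]
    ring

theorem abs_rpow_half_sub_one_sq (q y : ℝ) :
    (|y| ^ (q / 2 - 1)) ^ 2 = |y| ^ (q - 2) := by
  rw [← Real.rpow_natCast, ← Real.rpow_mul (abs_nonneg y)]
  congr 1
  push_cast
  ring

theorem abs_mul_abs_rpow_half {q : ℝ} (hq : 2 ≤ q) (y : ℝ) :
    |y * |y| ^ (q / 2 - 1)| = |y| ^ (q / 2) := by
  rw [abs_mul, abs_of_nonneg (Real.rpow_nonneg (abs_nonneg y) _), mul_comm,
    ← Real.rpow_add_one' (abs_nonneg y) (by linarith)]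
  congr 1
  ring

theorem mul_abs_rpow_half_sq {q : ℝ} (hq : 2 ≤ q) (y : ℝ) :
    (y * |y| ^ (q / 2 - 1)) ^ 2 = |y| ^ q := by
  rw [← sq_abs, abs_mul_abs_rpow_half hq, ← Real.rpow_natCast, ← Real.rpow_mul (abs_nonneg y)]
  congr 1
  push_cast
  ring

/-- This is the integrand form of the energy estimate, with `σ = |u|^(q/2 - 1)`. The first bracket
on the right is an exact `x`-derivative and will integrate to zero. Half of the dissipation
`(4(q-1)/q) v₁²` pays for the drift term by Young's inequality. The remaining terms all carry a
derivative of the cutoff and form the `ε` error. -/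
theorem energy_pointwise {q : ℝ} (hq : 2 ≤ q) {B c M ε u u₁ u₂ b b₁ η η₁ η₂ σ : ℝ}
    (hB : |b - c| ≤ B) (hBM : B ≤ M) (hc : |c| ≤ M) (hε : ε ≤ 1)
    (hη : |η| ≤ 1) (hη₁ : |η₁| ≤ ε) (hη₂ : |η₂| ≤ ε) :
    q * (u * σ ^ 2) * (u₂ - (b₁ * u + b * u₁)) * η ^ 2 ≤
      (q * ((q - 1) * σ ^ 2 * u₁) * (u₁ - (b - c) * u) * η ^ 2
        + q * (u * σ ^ 2) * (u₂ - (b₁ * u + (b - c) * u₁)) * η ^ 2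
        + q * (u * σ ^ 2) * (u₁ - (b - c) * u) * (2 * η * η₁)
        + (-c * (2 * η * η₁) + (4 * (q - 1) / q - 2) * (η₁ ^ 2 + η * η₂)) * (u * σ) ^ 2
        + (-c * η ^ 2 + (4 * (q - 1) / q - 2) * (η * η₁))
          * (2 * (u * σ) * (q / 2 * σ * u₁)))
      - 2 * (q - 1) / q * ((η₁ * (u * σ) + η * (q / 2 * σ * u₁)) ^ 2
          - (q * B / 2) ^ 2 * (η * (u * σ)) ^ 2)
      + (8 + 4 * q * M) * ε * (u * σ) ^ 2 := by
  have hq0 : 0 < q := by linarith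
  set v := η * (u * σ) with hv
  set v₁ := η₁ * (u * σ) + η * (q / 2 * σ * u₁) with hv₁
  have hε0 : 0 ≤ ε := (abs_nonneg _).trans hη₁
  have hM : 0 ≤ M := (abs_nonneg _).trans hc
  have hY : 2 * (q - 1) * (b - c) * v * v₁ ≤
      2 * (q - 1) / q * (v₁ ^ 2 + (q * B / 2) ^ 2 * v ^ 2) := by
    have h1 : 2 * (q - 1) * (b - c) * v * v₁ ≤ 2 * (q - 1) * (B * (|v| * |v₁|)) := by
      have : (b - c) * (v * v₁) ≤ B * (|v| * |v₁|) := by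
        rw [← abs_mul]
        refine (le_abs_self _).trans ?_
        rw [abs_mul]
        exact mul_le_mul_of_nonneg_right hB (abs_nonneg _)
      have := mul_le_mul_of_nonneg_left this (show 0 ≤ 2 * (q - 1) by linarith)
      linarith
    refine h1.trans ?_
    have h2 : 0 ≤ (q - 1) / q * (2 * (|v₁| - q * B / 2 * |v|) ^ 2) :=
      mul_nonneg (div_nonneg (by linarith) hq0.le) (by positivity)
    rw [sub_sq, mul_pow, sq_abs, sq_abs] at h2
    have h3 : (q - 1) / q * (2 * (v₁ ^ 2 - 2 * |v₁| * (q * B / 2 * |v|) + (q * B / 2) ^ 2 * v ^ 2))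
      = 2 * (q - 1) / q * (v₁ ^ 2 + (q * B / 2) ^ 2 * v ^ 2)
        - 2 * (q - 1) * (B * (|v| * |v₁|)) := by
      field_simp
      ring
    linarith
  have hE : -(4 * (q - 1) / q * (η * η₂) + 2 * (q - 1) * (b - c) * (η * η₁)
      - (2 * (η * η₁) * (q * (b - c) + c) + 2 * η₁ ^ 2 + 2 * (η * η₂)))
      ≤ (8 + 4 * q * M) * ε := by
    have ha : |η * η₁| ≤ ε := by
      rw [abs_mul]; nlinarith [abs_nonneg η, abs_nonneg η₁]
    have hb : |η * η₂| ≤ ε := by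
      rw [abs_mul]; nlinarith [abs_nonneg η, abs_nonneg η₂]
    have hd : η₁ ^ 2 ≤ ε := by
      rw [← sq_abs]; nlinarith [abs_nonneg η₁]
    have hk : |4 * (q - 1) / q - 2| ≤ 2 := by
      have e : 4 * (q - 1) / q = 4 - 4 / q := by field_simp
      have h1 : 0 ≤ 4 / q := by positivity
      have h2 : 4 / q ≤ 2 := by rw [div_le_iff₀ hq0]; linarith
      rw [e, abs_le]; constructor <;> linarith
    have t1 : -((4 * (q - 1) / q - 2) * (η * η₂)) ≤ 2 * ε := by
      refine (neg_le_abs _).trans ?_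
      rw [abs_mul]
      exact mul_le_mul hk hb (abs_nonneg _) (by norm_num)
    have t2 : (2 * (b - c) + 2 * c) * (η * η₁) ≤ 4 * M * ε := by
      refine (le_abs_self _).trans ?_
      rw [abs_mul]
      refine mul_le_mul ?_ ha (abs_nonneg _) (by linarith)
      refine (abs_add_le _ _).trans ?_
      rw [abs_mul, abs_mul, abs_two]
      linarith
    have t3 : 0 ≤ M * ε * (q - 1) := mul_nonneg (mul_nonneg hM hε0) (by linarith)
    nlinarith
  have hE' := mul_le_mul_of_nonneg_right hE (sq_nonneg (u * σ))
  have hid : (q * ((q - 1) * σ ^ 2 * u₁) * (u₁ - (b - c) * u) * η ^ 2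
        + q * (u * σ ^ 2) * (u₂ - (b₁ * u + (b - c) * u₁)) * η ^ 2
        + q * (u * σ ^ 2) * (u₁ - (b - c) * u) * (2 * η * η₁)
        + (-c * (2 * η * η₁) + (4 * (q - 1) / q - 2) * (η₁ ^ 2 + η * η₂)) * (u * σ) ^ 2
        + (-c * η ^ 2 + (4 * (q - 1) / q - 2) * (η * η₁))
          * (2 * (u * σ) * (q / 2 * σ * u₁)))
      = q * (u * σ ^ 2) * (u₂ - (b₁ * u + b * u₁)) * η ^ 2
        + 2 * (2 * (q - 1) / q) * v₁ ^ 2 - 2 * (q - 1) * (b - c) * v * v₁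
        + (4 * (q - 1) / q * (η * η₂) + 2 * (q - 1) * (b - c) * (η * η₁)
      - (2 * (η * η₁) * (q * (b - c) + c) + 2 * η₁ ^ 2 + 2 * (η * η₂))) * (u * σ) ^ 2 := by
    rw [hv, hv₁]
    field_simp
    ring
  rw [hid]
  linarith

/-- The energy inequality at a fixed time, localized by a cutoff `η`. The number `J` is the
Dirichlet integral of the truncated signed power `η u |u|^(q/2 - 1)`, and it controls the
energy by the Nash inequality. -/
theorem energy_dissipation {q : ℝ} (hq : 2 ≤ q) {u u₁ u₂ b b₁ η η₁ η₂ : ℝ → ℝ} {B c M ε ρ : ℝ}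
    (hu : ∀ x, HasDerivAt u (u₁ x) x) (hu₁ : ∀ x, HasDerivAt u₁ (u₂ x) x) (hu₂ : Continuous u₂)
    (hb : ∀ x, HasDerivAt b (b₁ x) x) (hb₁ : Continuous b₁)
    (hη : ∀ x, HasDerivAt η (η₁ x) x) (hη₁ : ∀ x, HasDerivAt η₁ (η₂ x) x) (hη₂ : Continuous η₂)
    (hB : ∀ x, |b x - c| ≤ B) (hBM : B ≤ M) (hc : |c| ≤ M) (hε : ε ≤ 1)
    (hηb : ∀ x, |η x| ≤ 1) (hηb₁ : ∀ x, |η₁ x| ≤ ε) (hηb₂ : ∀ x, |η₂ x| ≤ ε)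
    (hηρ : tsupport η ⊆ Icc (-ρ) ρ) :
    ∃ J : ℝ, 0 ≤ J ∧
      (∫ x, |u x| ^ q * η x ^ 2) ^ 3
        ≤ 27 / (16 * π ^ 2) * (∫ x, |u x| ^ (q / 2) * |η x|) ^ 4 * J ∧
      ∫ x, q * (u x * |u x| ^ (q - 2)) * (u₂ x - (b₁ x * u x + b x * u₁ x)) * η x ^ 2 ≤
        -(2 * (q - 1) / q) * (J - (q * B / 2) ^ 2 * ∫ x, |u x| ^ q * η x ^ 2)
          + (8 + 4 * q * M) * ε * ∫ x in Icc (-ρ) ρ, |u x| ^ q := by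
  have cont : ∀ {f f' : ℝ → ℝ}, (∀ x, HasDerivAt f (f' x) x) → Continuous f := fun h =>
    continuous_iff_continuousAt.2 fun x => (h x).continuousAt
  have cu := cont hu
  have cu₁ := cont hu₁
  have cb := cont hb
  have cη := cont hη
  have cη₁ := cont hη₁
  have sη : HasCompactSupport η := isCompact_Icc.of_isClosed_subset (isClosed_tsupport _) hηρ
  have dη : deriv η = η₁ := funext fun x => (hη x).deriv
  have dη₁ : deriv η₁ = η₂ := funext fun x => (hη₁ x).deriv
  have s₁ : tsupport η₁ ⊆ tsupport η := dη ▸ tsupport_deriv_subset (𝕜 := ℝ)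
  have s₂ : tsupport η₂ ⊆ tsupport η := (dη₁ ▸ tsupport_deriv_subset (𝕜 := ℝ)).trans s₁
  set σ : ℝ → ℝ := fun x => |u x| ^ (q / 2 - 1) with hσ
  have cσ : Continuous σ := cu.abs.rpow_const fun _ => Or.inr (by linarith)
  have hw : ∀ x, HasDerivAt (fun x => u x * σ x) (q / 2 * σ x * u₁ x) x := fun x => by
    have := (hasDerivAt_mul_abs_rpow (a := q / 2 - 1) (by linarith) (u x)).comp x (hu x)
    rwa [sub_add_cancel] at this
  have hZ : ∀ x, HasDerivAt (fun x => u x * σ x ^ 2) ((q - 1) * σ x ^ 2 * u₁ x) x := fun x => by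
    have := (hasDerivAt_mul_abs_rpow (a := q - 2) (by linarith) (u x)).comp x (hu x)
    simp only [hσ, abs_rpow_half_sub_one_sq]
    rwa [show q - 2 + 1 = q - 1 by ring] at this
  have cw := cont hw
  have hv : ∀ x, HasDerivAt (fun x => η x * (u x * σ x))
      (η₁ x * (u x * σ x) + η x * (q / 2 * σ x * u₁ x)) x := fun x => (hη x).mul (hw x)
  have hvc : Continuous fun x => η₁ x * (u x * σ x) + η x * (q / 2 * σ x * u₁ x) := by fun_prop
  have hvs : HasCompactSupport fun x => η x * (u x * σ x) := sη.mul_right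
  have hN := nash_inequality hv hvc hvs
  have eE : ∀ x, (η x * (u x * σ x)) ^ 2 = |u x| ^ q * η x ^ 2 := fun x => by
    rw [mul_pow, mul_abs_rpow_half_sq hq, mul_comm]
  have eN : ∀ x, |η x * (u x * σ x)| = |u x| ^ (q / 2) * |η x| := fun x => by
    rw [abs_mul, abs_mul_abs_rpow_half hq, mul_comm]
  simp only [eE, eN] at hN
  refine ⟨_, integral_nonneg fun x => sq_nonneg _, hN, ?_⟩
  -- The choice of `κ` completes the square: with `w = u σ`, the terms in `η η₁ w w'` have
  -- coefficient `4 + 2 κ = 8 (q - 1) / q`, as in `(4 (q - 1) / q) (η w)'²`.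
  set κ : ℝ := 4 * (q - 1) / q - 2 with hκ
  -- `G` is the total flux: diffusion and drift relative to `c`, then the transport of `|u|^q` by
  -- the constant `c`, then the correction by `κ`.
  set G : ℝ → ℝ := fun x => q * (u x * σ x ^ 2) * (u₁ x - (b x - c) * u x) * η x ^ 2
    + (-c * η x ^ 2 + κ * (η x * η₁ x)) * (u x * σ x) ^ 2 with hG
  set G' : ℝ → ℝ := fun x => q * ((q - 1) * σ x ^ 2 * u₁ x) * (u₁ x - (b x - c) * u x) * η x ^ 2
        + q * (u x * σ x ^ 2) * (u₂ x - (b₁ x * u x + (b x - c) * u₁ x)) * η x ^ 2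
        + q * (u x * σ x ^ 2) * (u₁ x - (b x - c) * u x) * (2 * η x * η₁ x)
        + (-c * (2 * η x * η₁ x) + κ * (η₁ x ^ 2 + η x * η₂ x)) * (u x * σ x) ^ 2
        + (-c * η x ^ 2 + κ * (η x * η₁ x))
          * (2 * (u x * σ x) * (q / 2 * σ x * u₁ x)) with hG'
  have hGd : ∀ x, HasDerivAt G (G' x) x := fun x => by
    have h1 := (((hZ x).const_mul q).mul ((hu₁ x).sub (((hb x).sub_const c).mul (hu x)))).mul
      ((hη x).pow 2)
    have h2 := ((((hη x).pow 2).const_mul (-c)).add (((hη x).mul (hη₁ x)).const_mul κ)).mul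
      ((hw x).pow 2)
    refine (h1.add h2).congr_deriv ?_
    simp only [hG', Pi.mul_apply, Pi.pow_apply, Pi.sub_apply, Pi.add_apply]
    norm_num
    ring
  have hz : ∀ x, x ∉ tsupport η → η x = 0 ∧ η₁ x = 0 ∧ η₂ x = 0 := fun x hx =>
    ⟨image_eq_zero_of_notMem_tsupport hx, image_eq_zero_of_notMem_tsupport fun h => hx (s₁ h),
      image_eq_zero_of_notMem_tsupport fun h => hx (s₂ h)⟩
  have hint : ∀ {f : ℝ → ℝ}, Continuous f → (∀ x, η x = 0 → η₁ x = 0 → η₂ x = 0 → f x = 0) →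
      Integrable f := fun hf h =>
    hf.integrable_of_hasCompactSupport (HasCompactSupport.intro sη fun x hx =>
      h x (hz x hx).1 (hz x hx).2.1 (hz x hx).2.2)
  have hG0 : ∫ x, G' x = 0 := by
    refine integral_eq_zero_of_hasDerivAt_of_integrable hGd (hint (by fun_prop) ?_)
      (hint (cont hGd) ?_)
    · intro x h0 h1 h2; simp [hG', h0, h1, h2]
    · intro x h0 h1 h2; simp [hG, h0]
  have cq : Continuous fun x => |u x| ^ q := cu.abs.rpow_const fun _ => Or.inr (by linarith)
  have iG : Integrable G' := hint (by fun_prop) fun x h0 h1 h2 => by simp [hG', h0, h1, h2]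
  have iJ : Integrable fun x => (η₁ x * (u x * σ x) + η x * (q / 2 * σ x * u₁ x)) ^ 2 :=
    hint (by fun_prop) fun x h0 h1 h2 => by simp [h0, h1]
  have iE : Integrable fun x => |u x| ^ q * η x ^ 2 :=
    hint (by fun_prop) fun x h0 h1 h2 => by simp [h0]
  have iI : Integrable ((Icc (-ρ) ρ).indicator fun x => |u x| ^ q) :=
    (integrable_indicator_iff measurableSet_Icc).2 (cq.integrableOn_Icc)
  have iK : Integrable fun x => (η₁ x * (u x * σ x) + η x * (q / 2 * σ x * u₁ x)) ^ 2
      - (q * B / 2) ^ 2 * (|u x| ^ q * η x ^ 2) := iJ.sub (iE.const_mul _)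
  have iR : Integrable fun x => G' x - 2 * (q - 1) / q
      * ((η₁ x * (u x * σ x) + η x * (q / 2 * σ x * u₁ x)) ^ 2
        - (q * B / 2) ^ 2 * (|u x| ^ q * η x ^ 2)) := iG.sub (iK.const_mul _)
  have iL : Integrable fun x => q * (u x * |u x| ^ (q - 2))
      * (u₂ x - (b₁ x * u x + b x * u₁ x)) * η x ^ 2 := by
    simp only [← abs_rpow_half_sub_one_sq]
    exact hint (f := fun x => q * (u x * σ x ^ 2) * (u₂ x - (b₁ x * u x + b x * u₁ x)) * η x ^ 2)
      (by fun_prop) fun x h0 h1 h2 => by simp [h0]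
  have hmono := integral_mono iL (iR.add (iI.const_mul ((8 + 4 * q * M) * ε))) fun x => ?_
  · refine hmono.trans (le_of_eq ?_)
    simp only [Pi.add_apply]
    rw [integral_add iR (iI.const_mul _), integral_sub iG (iK.const_mul _), hG0,
      integral_const_mul, integral_const_mul, integral_sub iJ (iE.const_mul _),
      integral_const_mul, integral_indicator measurableSet_Icc]
    ring
  · simp only [Pi.add_apply]
    have hp := energy_pointwise hq (u := u x) (u₁ := u₁ x) (u₂ := u₂ x) (b₁ := b₁ x) (σ := σ x)
      (hB x) hBM hc hε (hηb x) (hηb₁ x) (hηb₂ x)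
    rw [eE, ← hκ] at hp
    by_cases hx : x ∈ Icc (-ρ) ρ
    · rw [indicator_of_mem hx, ← abs_rpow_half_sub_one_sq, ← mul_abs_rpow_half_sq hq (u x)]
      rw [← mul_abs_rpow_half_sq hq (u x)] at hp
      exact hp
    · obtain ⟨h0, h1, h2⟩ := hz x fun h => hx (hηρ h)
      simp [indicator_of_notMem hx, h0, h1, h2, hG']

/-! ### Cutoffs, and the energy inequality for solutions. -/

/-- `η` is a cutoff function, equal to `1` on `[-R, R]` and supported in `[-2R, 2R]`, whose first
two derivatives are bounded by `ε`. -/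
structure IsCutoff (η : ℝ → ℝ) (R ε : ℝ) : Prop where
  contDiff : ContDiff ℝ 2 η
  nonneg : ∀ x, 0 ≤ η x
  le_one : ∀ x, η x ≤ 1
  eq_one : ∀ x ∈ Icc (-R) R, η x = 1
  tsupport_subset : tsupport η ⊆ Icc (-(2 * R)) (2 * R)
  abs_deriv_le : ∀ x, |deriv η x| ≤ ε
  abs_deriv_deriv_le : ∀ x, |deriv (deriv η) x| ≤ ε

/-- A fixed bump is rescaled. The second derivative is of order `R⁻²`, but for `R ≥ 1` the common
bound of order `R⁻¹` is enough. -/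
theorem exists_isCutoff : ∃ L : ℝ, 0 < L ∧ ∀ R : ℝ, 1 ≤ R → ∃ η, IsCutoff η R (L / R) := by
  let f : ContDiffBump (0 : ℝ) := ⟨1, 2, one_pos, one_lt_two⟩
  have hf : ContDiff ℝ 2 f := f.contDiff
  have hf2 : ContDiff ℝ 1 (deriv f) := (contDiff_succ_iff_deriv (n := 1)).1 hf |>.2.2
  have hsf : HasCompactSupport f := f.hasCompactSupport
  obtain ⟨L₁, hL₁⟩ := (hf2.continuous.bounded_above_of_compact_support hsf.deriv)
  obtain ⟨L₂, hL₂⟩ := ((hf2.continuous_deriv le_rfl).bounded_above_of_compact_support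
    hsf.deriv.deriv)
  have h1 : 0 ≤ L₁ := (norm_nonneg _).trans (hL₁ 0)
  have h2 : 0 ≤ L₂ := (norm_nonneg _).trans (hL₂ 0)
  refine ⟨L₁ + L₂ + 1, by linarith, fun R hR => ⟨fun x => f (R⁻¹ * x), ?_⟩⟩
  have hR0 : 0 < R := by linarith
  have d1 : deriv (fun x => f (R⁻¹ * x)) = fun x => R⁻¹ * deriv f (R⁻¹ * x) := by
    ext x
    rw [deriv_comp_mul_left, smul_eq_mul]
  have d2 : deriv (deriv (fun x => f (R⁻¹ * x))) =
      fun x => R⁻¹ * (R⁻¹ * deriv (deriv f) (R⁻¹ * x)) := by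
    ext x
    rw [d1, deriv_const_mul_field, deriv_comp_mul_left, smul_eq_mul]
  have hRi : R⁻¹ ≤ 1 := inv_le_one_of_one_le₀ hR
  have hRi0 : 0 < R⁻¹ := inv_pos.2 hR0
  refine ⟨hf.comp (contDiff_const.mul contDiff_id), fun x => f.nonneg, fun x => f.le_one,
    fun x hx => f.one_of_mem_closedBall ?_, ?_, fun x => ?_, fun x => ?_⟩
  · rw [mem_closedBall_zero_iff, Real.norm_eq_abs, abs_mul, abs_of_pos hRi0, inv_mul_le_iff₀ hR0]
    simpa [f] using abs_le.2 hx
  · refine closure_minimal (fun x hx => ?_) isClosed_Icc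
    have : R⁻¹ * x ∈ Function.support f := hx
    rw [f.support_eq, mem_ball_zero_iff, Real.norm_eq_abs, abs_mul, abs_of_pos hRi0,
      inv_mul_lt_iff₀ hR0] at this
    have h3 : |x| < 2 * R := by simpa [f, mul_comm] using this
    exact abs_le.1 h3.le
  · rw [d1, abs_mul, abs_of_pos hRi0, div_eq_inv_mul]
    refine mul_le_mul_of_nonneg_left ?_ hRi0.le
    have := hL₁ (R⁻¹ * x)
    rw [Real.norm_eq_abs] at this
    linarith
  · rw [d2, abs_mul, abs_mul, abs_of_pos hRi0, div_eq_inv_mul]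
    refine mul_le_mul_of_nonneg_left ?_ hRi0.le
    have := hL₂ (R⁻¹ * x)
    rw [Real.norm_eq_abs] at this
    nlinarith [abs_nonneg (deriv (deriv f) (R⁻¹ * x))]

/-- The localized `L^q` energy of `u` at time `t`. -/
noncomputable def cutoffEnergy (u : ℝ → ℝ → ℝ) (q : ℝ) (η : ℝ → ℝ) (t : ℝ) : ℝ :=
  ∫ x, |u x t| ^ q * η x ^ 2

namespace AdvDiff

theorem IsC21.continuous_space {T : EReal} {u : ℝ → ℝ → ℝ} (hu : IsC21 T u) {t : ℝ} (ht : 0 < t)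
    (htT : (t : EReal) < T) : Continuous fun x => u x t :=
  (hu.contDiff_space t ht htT).continuous

theorem IsC21.continuous_deriv_time {T : EReal} {u : ℝ → ℝ → ℝ} (hu : IsC21 T u) {t : ℝ}
    (ht : 0 < t) (htT : (t : EReal) < T) : Continuous fun x => deriv (fun s => u x s) t :=
  hu.continuousOn_t.comp_continuous (f := fun x : ℝ => (x, t)) (by fun_prop) fun _ => ⟨ht, htT⟩

/-- Differentiation under the integral is legitimate because the cutoff confines the integrand to a
compact interval; joint continuity on a compact box away from time `0` supplies the dominating
constant. -/
theorem IsC21.hasDerivAt_cutoffEnergy {T : EReal} {u : ℝ → ℝ → ℝ} (hu : IsC21 T u) {q : ℝ}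
    (hq : 2 ≤ q) {η : ℝ → ℝ} {ρ : ℝ} (hη : Continuous η) (hηρ : tsupport η ⊆ Icc (-ρ) ρ) {τ : ℝ}
    (hτ : 0 < τ) (hτT : (τ : EReal) < T) :
    HasDerivAt (cutoffEnergy u q η)
      (∫ x, q * (u x τ * |u x τ| ^ (q - 2)) * deriv (fun s => u x s) τ * η x ^ 2) τ := by
  obtain ⟨S, hτS, hST⟩ := EReal.lt_iff_exists_real_btwn.1 hτT
  have hτS : τ < S := by exact_mod_cast hτS
  have hs : Icc (τ / 2) S ∈ 𝓝 τ := Icc_mem_nhds (by linarith) hτS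
  have hsT : ∀ t ∈ Icc (τ / 2) S, 0 < t ∧ (t : EReal) < T := fun t ht =>
    ⟨by linarith [ht.1], lt_of_le_of_lt (by exact_mod_cast ht.2) hST⟩
  set F' : ℝ → ℝ → ℝ := fun t x =>
    q * (u x t * |u x t| ^ (q - 2)) * deriv (fun s => u x s) t * η x ^ 2 with hF'
  have hcont : ContinuousOn (fun z : ℝ × ℝ => F' z.2 z.1) (openSlab T) := by
    refine ((continuousOn_const.mul (hu.continuousOn.mul
      (hu.continuousOn.abs.rpow_const fun z _ => Or.inr ?_))).mul hu.continuousOn_t).mul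
      ((hη.comp continuous_fst).continuousOn.pow 2)
    linarith
  obtain ⟨C, hC⟩ := (isCompact_Icc.prod isCompact_Icc :
    IsCompact (Icc (-ρ) ρ ×ˢ Icc (τ / 2) S)).exists_bound_of_continuousOn
      (hcont.mono fun z hz => hsT z.2 hz.2)
  have hz : ∀ x, x ∉ Icc (-ρ) ρ → η x = 0 := fun x hx =>
    image_eq_zero_of_notMem_tsupport fun h => hx (hηρ h)
  have hF : ∀ t ∈ Icc (τ / 2) S, Continuous fun x => |u x t| ^ q * η x ^ 2 := fun t ht =>
    ((hu.continuous_space (hsT t ht).1 (hsT t ht).2).abs.rpow_const fun _ =>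
      Or.inr (by linarith)).mul (hη.pow 2)
  refine (hasDerivAt_integral_of_dominated_loc_of_deriv_le
    (F := fun t x => |u x t| ^ q * η x ^ 2) (F' := F')
    (bound := (Icc (-ρ) ρ).indicator fun _ => C) hs ?_ ?_ ?_ ?_ ?_ ?_).2
  · filter_upwards [hs] with t ht
    exact (hF t ht).aestronglyMeasurable
  · refine (hF τ (mem_of_mem_nhds hs)).integrable_of_hasCompactSupport
      (HasCompactSupport.intro (isCompact_Icc (a := -ρ) (b := ρ)) fun x hx => ?_)
    simp [hz x hx]
  · refine Continuous.aestronglyMeasurable ?_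
    have h0 := hu.continuous_space hτ hτT
    exact ((continuous_const.mul (h0.mul (h0.abs.rpow_const fun _ =>
      Or.inr (by linarith)))).mul (hu.continuous_deriv_time hτ hτT)).mul (hη.pow 2)
  · refine Eventually.of_forall fun x t ht => ?_
    by_cases hx : x ∈ Icc (-ρ) ρ
    · rw [indicator_of_mem hx]
      exact hC (x, t) ⟨hx, ht⟩
    · simp [hF', hz x hx, indicator_of_notMem hx]
  · exact (integrable_indicator_iff measurableSet_Icc).2 continuous_const.integrableOn_Icc
  · refine Eventually.of_forall fun x t ht => ?_
    have h1 := (hasDerivAt_abs_rpow (u x t) (p := q) (by linarith)).comp t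
      (hu.differentiable_time x t (hsT t ht).1 (hsT t ht).2).hasDerivAt
    refine (h1.mul_const (η x ^ 2)).congr_deriv ?_
    simp only [hF']
    ring

/-- Up to cutoff errors the energy identity is blind to adding a constant to `b`. Subtracting the
midrange is the choice that leaves the half oscillation as the bound on the drift. -/
theorem abs_sub_le_halfOsc {b : ℝ → ℝ → ℝ} {M t : ℝ} (hM : ∀ x, |b x t| ≤ M) (x : ℝ) :
    |b x t - ((⨆ x : ℝ, b x t) + ⨅ x : ℝ, b x t) / 2| ≤ halfOsc b t := by
  have h1 := le_ciSup (f := fun x => b x t)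
    ⟨M, by rintro _ ⟨y, rfl⟩; exact (abs_le.1 (hM y)).2⟩ x
  have h2 := ciInf_le (f := fun x => b x t)
    ⟨-M, by rintro _ ⟨y, rfl⟩; exact (abs_le.1 (hM y)).1⟩ x
  rw [halfOsc, abs_le]
  constructor <;> linarith

theorem ciSup_ciInf_bounds {b : ℝ → ℝ → ℝ} {M t : ℝ} (hM : ∀ x, |b x t| ≤ M) :
    (⨆ x : ℝ, b x t) ≤ M ∧ -M ≤ ⨆ x : ℝ, b x t ∧ (⨅ x : ℝ, b x t) ≤ M
      ∧ -M ≤ ⨅ x : ℝ, b x t := by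
  have h1 := le_ciSup (f := fun x => b x t)
    ⟨M, by rintro _ ⟨y, rfl⟩; exact (abs_le.1 (hM y)).2⟩ 0
  have h2 := ciInf_le (f := fun x => b x t)
    ⟨-M, by rintro _ ⟨y, rfl⟩; exact (abs_le.1 (hM y)).1⟩ 0
  have h3 := abs_le.1 (hM 0)
  exact ⟨ciSup_le fun y => (abs_le.1 (hM y)).2, h3.1.trans h1, h2.trans h3.2,
    le_ciInf fun y => (abs_le.1 (hM y)).1⟩

theorem halfOsc_le {b : ℝ → ℝ → ℝ} {M t : ℝ} (hM : ∀ x, |b x t| ≤ M) : halfOsc b t ≤ M := by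
  obtain ⟨h1, -, -, h2⟩ := ciSup_ciInf_bounds hM
  rw [halfOsc]
  linarith

/-- The differential inequality for the localized energy of a solution, together with the Nash
bound on the dissipation term `J`. -/
theorem IsSolution.exists_energy_inequality {b : ℝ → ℝ → ℝ} {u₀ : ℝ → ℝ} {T : EReal}
    {u : ℝ → ℝ → ℝ} (hu : IsSolution b u₀ T u) (hb : IsAdvectionField b) {q : ℝ} (hq : 2 ≤ q)
    {η : ℝ → ℝ} {R ε B M τ : ℝ} (hη : IsCutoff η R ε) (hε : ε ≤ 1) (hM : ∀ x, |b x τ| ≤ M)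
    (hB : halfOsc b τ ≤ B) (hBM : B ≤ M) (hτ : 0 < τ) (hτT : (τ : EReal) < T) :
    ∃ E' J : ℝ, HasDerivAt (cutoffEnergy u q η) E' τ ∧ 0 ≤ J ∧
      cutoffEnergy u q η τ ^ 3
        ≤ 27 / (16 * π ^ 2) * (∫ x, |u x τ| ^ (q / 2) * η x) ^ 4 * J ∧
      E' ≤ -(2 * (q - 1) / q) * (J - (q * B / 2) ^ 2 * cutoffEnergy u q η τ)
          + (8 + 4 * q * M) * ε * ∫ x in Icc (-(2 * R)) (2 * R), |u x τ| ^ q := by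
  have cu := hu.regular.contDiff_space τ hτ hτT
  have cu1 : ContDiff ℝ 1 (deriv fun x => u x τ) :=
    ((contDiff_succ_iff_deriv (n := 1)).1 cu).2.2
  have cη1 : ContDiff ℝ 1 (deriv η) := ((contDiff_succ_iff_deriv (n := 1)).1 hη.contDiff).2.2
  have cb : ContDiff ℝ 1 fun x => b x τ :=
    hb.contDiffOn.comp_contDiff (f := fun x : ℝ => (x, τ)) (by fun_prop) fun _ => hτ.le
  have hbd := ciSup_ciInf_bounds hM
  obtain ⟨J, hJ, hN, hE⟩ := energy_dissipation hq (η := η) (ρ := 2 * R) (B := B) (M := M) (ε := ε)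
    (c := ((⨆ x : ℝ, b x τ) + ⨅ x : ℝ, b x τ) / 2)
    (fun x => (cu.differentiable two_ne_zero x).hasDerivAt)
    (fun x => (cu1.differentiable one_ne_zero x).hasDerivAt) (cu1.continuous_deriv le_rfl)
    (fun x => (cb.differentiable one_ne_zero x).hasDerivAt) (cb.continuous_deriv le_rfl)
    (fun x => (hη.contDiff.differentiable two_ne_zero x).hasDerivAt)
    (fun x => (cη1.differentiable one_ne_zero x).hasDerivAt) (cη1.continuous_deriv le_rfl)
    (fun x => (abs_sub_le_halfOsc hM x).trans hB) hBM
    (abs_le.2 ⟨by linarith [hbd.2.1, hbd.2.2.2], by linarith [hbd.1, hbd.2.2.1]⟩) hε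
    (fun x => abs_le.2 ⟨by linarith [hη.nonneg x], hη.le_one x⟩) hη.abs_deriv_le
    hη.abs_deriv_deriv_le hη.tsupport_subset
  simp only [abs_of_nonneg (hη.nonneg _)] at hN
  refine ⟨_, J, hu.regular.hasDerivAt_cutoffEnergy hq hη.contDiff.continuous hη.tsupport_subset
    hτ hτT, hJ, hN, ?_⟩
  refine le_trans (le_of_eq (integral_congr_ae (Eventually.of_forall fun x => ?_))) hE
  have heq := hu.equation x τ hτ hτT
  have hd : deriv (fun y => b y τ * u y τ) x
      = deriv (fun y => b y τ) x * u x τ + b x τ * deriv (fun y => u y τ) x :=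
    (((cb.differentiable one_ne_zero x).hasDerivAt).mul
      ((cu.differentiable two_ne_zero x).hasDerivAt)).deriv
  have h2 : iteratedDeriv 2 (fun y => u y τ) x = deriv (deriv fun y => u y τ) x := by
    rw [iteratedDeriv_succ, iteratedDeriv_one]
  rw [hd, h2] at heq
  rw [← heq]
  ring

theorem IsSolution.abs_le_of_pos {b : ℝ → ℝ → ℝ} {u₀ : ℝ → ℝ} {T : EReal} {u : ℝ → ℝ → ℝ}
    (hu : IsSolution b u₀ T u) {M t : ℝ} (ht : 0 < t) (htT : (t : EReal) < T)
    (hM : ∀ᵐ x, |u x t| ≤ M) (x : ℝ) : |u x t| ≤ M := by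
  have hc : IsClosed {x | |u x t| ≤ M} :=
    isClosed_le (hu.regular.continuous_space ht htT).abs continuous_const
  have hd : Dense {x | |u x t| ≤ M} := Measure.dense_of_ae hM
  have := hd.closure_eq
  rw [hc.closure_eq] at this
  exact this.ge (mem_univ x)

end AdvDiff

/-! ### Comparison arguments in time, and passage from cutoffs to the whole line. -/

theorem abs_abs_rpow_sub_abs_rpow_le {q M : ℝ} (hq : 2 ≤ q) {y z : ℝ} (hy : |y| ≤ M)
    (hz : |z| ≤ M) : |(|y| ^ q - |z| ^ q)| ≤ q * M ^ (q - 2) * M * |y - z| := by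
  refine (convex_Icc (-M) M).norm_image_sub_le_of_norm_hasDerivWithin_le (𝕜 := ℝ)
    (f := fun y => |y| ^ q) (fun x _ => (hasDerivAt_abs_rpow x (by linarith)).hasDerivWithinAt)
    (fun x hx => ?_) (abs_le.1 hz) (abs_le.1 hy)
  have hx' : |x| ≤ M := abs_le.2 hx
  rw [Real.norm_eq_abs, abs_mul, abs_mul, abs_of_nonneg (by linarith : 0 ≤ q),
    abs_of_nonneg (Real.rpow_nonneg (abs_nonneg x) _)]
  have := Real.rpow_le_rpow (abs_nonneg x) hx' (by linarith : 0 ≤ q - 2)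
  have hM : 0 ≤ M := (abs_nonneg _).trans hx'
  gcongr

/-- If `E t` exceeded the maximum, then after the last time at which `E` lies below it `E` would
stay above `L`, hence would be nonincreasing, and could not have risen. -/
theorem le_max_of_deriv_nonpos {E : ℝ → ℝ} {a t L : ℝ} (hat : a ≤ t) (hc : ContinuousOn E (Icc a t))
    (hd : ∀ τ ∈ Ioo a t, ∃ E', HasDerivAt E E' τ ∧ (L < E τ → E' ≤ 0)) :
    E t ≤ max (E a) L := by
  by_contra! hlt
  have hS : IsCompact {σ ∈ Icc a t | E σ ≤ max (E a) L} :=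
    isCompact_Icc.of_isClosed_subset
      (hc.preimage_isClosed_of_isClosed isClosed_Icc isClosed_Iic) fun x hx => hx.1
  obtain ⟨σ, ⟨⟨haσ, hσt⟩, hσ⟩, hmax⟩ := hS.exists_isGreatest ⟨a, ⟨le_rfl, hat⟩, le_max_left _ _⟩
  have hanti : AntitoneOn E (Icc σ t) := by
    refine antitoneOn_of_deriv_nonpos (convex_Icc σ t) (hc.mono (Icc_subset_Icc_left haσ)) ?_ ?_
    · rw [interior_Icc]
      intro τ hτ
      obtain ⟨E', hE', -⟩ := hd τ ⟨haσ.trans_lt hτ.1, hτ.2⟩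
      exact hE'.differentiableAt.differentiableWithinAt
    · rw [interior_Icc]
      intro τ hτ
      obtain ⟨E', hE', hn⟩ := hd τ ⟨haσ.trans_lt hτ.1, hτ.2⟩
      rw [hE'.deriv]
      refine hn (lt_of_not_ge fun h => ?_)
      exact absurd (hmax ⟨⟨haσ.trans hτ.1.le, hτ.2.le⟩, h.trans (le_max_right _ _)⟩)
        (not_le.2 hτ.1)
  have := hanti (left_mem_Icc.2 hσt) (right_mem_Icc.2 hσt) hσt
  linarith

theorem le_add_mul_of_deriv_le {E : ℝ → ℝ} {a t C : ℝ} (hat : a ≤ t) (hc : ContinuousOn E (Icc a t))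
    (hd : ∀ τ ∈ Ioo a t, ∃ E', HasDerivAt E E' τ ∧ E' ≤ C) :
    E t ≤ E a + C * (t - a) := by
  have := (convex_Icc a t).image_sub_le_mul_sub_of_deriv_le hc (C := C) (by
    rw [interior_Icc]
    intro τ hτ
    obtain ⟨E', hE', -⟩ := hd τ hτ
    exact hE'.differentiableAt.differentiableWithinAt) (by
    rw [interior_Icc]
    intro τ hτ
    obtain ⟨E', hE', h⟩ := hd τ hτ
    rwa [hE'.deriv]) a (left_mem_Icc.2 hat) t (right_mem_Icc.2 hat) hat
  linarith

theorem enorm_rpow_eq_ofReal {q : ℝ} (hq : 0 ≤ q) (y : ℝ) :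
    ‖y‖ₑ ^ q = ENNReal.ofReal (|y| ^ q) := by
  rw [Real.enorm_eq_ofReal_abs, ENNReal.ofReal_rpow_of_nonneg (abs_nonneg y) hq]

/-- Integrability of `f` is not needed, since the Bochner integral of a non-integrable function is
`0`. -/
theorem ofReal_integral_le_lintegral_rpow {q : ℝ} (hq : 0 ≤ q) {μ : Measure ℝ} {f v : ℝ → ℝ}
    (h : ∀ x, |f x| ≤ |v x| ^ q) :
    ENNReal.ofReal (∫ x, f x ∂μ) ≤ ∫⁻ x, ‖v x‖ₑ ^ q ∂μ := by
  refine (Real.ofReal_le_enorm _).trans ((enorm_integral_le_lintegral_enorm _).trans ?_)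
  refine lintegral_mono fun x => ?_
  rw [enorm_rpow_eq_ofReal hq, Real.enorm_eq_ofReal_abs]
  exact ENNReal.ofReal_le_ofReal (h x)

namespace IsCutoff

variable {η : ℝ → ℝ} {R ε : ℝ}

theorem eq_zero (hη : IsCutoff η R ε) {x : ℝ} (hx : x ∉ Icc (-(2 * R)) (2 * R)) : η x = 0 :=
  image_eq_zero_of_notMem_tsupport fun h => hx (hη.tsupport_subset h)

theorem sq_le_one (hη : IsCutoff η R ε) (x : ℝ) : η x ^ 2 ≤ 1 :=
  pow_le_one₀ (hη.nonneg x) (hη.le_one x)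

theorem ofReal_cutoffEnergy_le (hη : IsCutoff η R ε) {q : ℝ} (hq : 0 ≤ q) (u : ℝ → ℝ → ℝ) (t : ℝ) :
    ENNReal.ofReal (cutoffEnergy u q η t) ≤ ∫⁻ x, ‖u x t‖ₑ ^ q := by
  refine ofReal_integral_le_lintegral_rpow hq fun x => ?_
  have h := Real.rpow_nonneg (abs_nonneg (u x t)) q
  rw [abs_of_nonneg (mul_nonneg h (sq_nonneg _))]
  exact mul_le_of_le_one_right h (hη.sq_le_one x)

theorem integrable (hη : IsCutoff η R ε) {q : ℝ} (hq : 0 ≤ q) {v : ℝ → ℝ} (hv : Continuous v) :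
    Integrable fun x => |v x| ^ q * η x ^ 2 := by
  refine Continuous.integrable_of_hasCompactSupport
    ((hv.abs.rpow_const fun _ => Or.inr hq).mul (hη.contDiff.continuous.pow 2))
    (HasCompactSupport.intro (isCompact_Icc (a := -(2 * R)) (b := 2 * R)) fun x hx => ?_)
  simp [hη.eq_zero hx]

theorem setLIntegral_le (hη : IsCutoff η R ε) {q : ℝ} (hq : 0 ≤ q) {u : ℝ → ℝ → ℝ} {t : ℝ}
    (hu : Continuous fun x => u x t) :
    ∫⁻ x in Icc (-R) R, ‖u x t‖ₑ ^ q ≤ ENNReal.ofReal (cutoffEnergy u q η t) := by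
  have h := fun x => Real.rpow_nonneg (abs_nonneg (u x t)) q
  rw [cutoffEnergy, ofReal_integral_eq_lintegral_ofReal (hη.integrable hq hu)
    (Eventually.of_forall fun x => mul_nonneg (h x) (sq_nonneg _)),
    ← lintegral_indicator measurableSet_Icc]
  refine lintegral_mono fun x => ?_
  by_cases hx : x ∈ Icc (-R) R
  · simp [indicator_of_mem hx, enorm_rpow_eq_ofReal hq, hη.eq_one x hx]
  · simp [indicator_of_notMem hx]

end IsCutoff

/-- The intervals `[-R, R]`, on which the cutoff equals `1`, exhaust the line. The cutoff may vary
with `R`, and finiteness of the whole integral comes out as a conclusion. -/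
theorem lintegral_le_of_eventually_cutoffEnergy_le {q : ℝ} (hq : 0 ≤ q) {u : ℝ → ℝ → ℝ} {t : ℝ}
    (hu : Continuous fun x => u x t) {c : ℝ≥0∞}
    (h : ∀ᶠ R : ℝ in atTop, ∃ η ε, IsCutoff η R ε ∧ ENNReal.ofReal (cutoffEnergy u q η t) ≤ c) :
    ∫⁻ x, ‖u x t‖ₑ ^ q ≤ c := by
  have hm : AEMeasurable (fun x => ‖u x t‖ₑ ^ q) (volume : Measure ℝ) :=
    hu.measurable.enorm.pow_const q |>.aemeasurable
  refine le_of_tendsto ((aecover_Icc (μ := (volume : Measure ℝ)) tendsto_neg_atTop_atBot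
    tendsto_id).lintegral_tendsto_of_countably_generated hm) ?_
  filter_upwards [h] with R hR
  obtain ⟨η, ε, hη, hc⟩ := hR
  exact (hη.setLIntegral_le hq hu).trans hc

/-! ### Evolution of the energy of a solution. -/

namespace AdvDiff

variable {b : ℝ → ℝ → ℝ} {u₀ : ℝ → ℝ} {T : EReal} {u : ℝ → ℝ → ℝ}

/-- The differential inequality is available only for positive times, so the initial time has to be
reached by continuity. On the bounded range of `u` the map `y ↦ |y|^q` is Lipschitz, and local `L¹`
convergence to the initial datum therefore passes to the energies. -/
theorem IsSolution.tendsto_cutoffEnergy_zero (hu : IsSolution b u₀ T u)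
    (hu₀ : AEStronglyMeasurable u₀ volume) {q : ℝ} (hq : 2 ≤ q) {η : ℝ → ℝ} {R ε S : ℝ}
    (hη : IsCutoff η R ε) (hS : 0 < S) (hST : (S : EReal) < T) :
    Tendsto (cutoffEnergy u q η) (𝓝[>] 0) (𝓝 (cutoffEnergy u q η 0)) := by
  obtain ⟨M, hM⟩ := hu.bounded S hS hST
  have hpos : ∀ᶠ t : ℝ in 𝓝[>] 0, t ∈ Ioc 0 S := Ioc_mem_nhdsGT hS
  have hcont : ∀ t ∈ Ioc 0 S, Continuous fun x => u x t := fun t ht =>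
    hu.regular.continuous_space ht.1 (lt_of_le_of_lt (by exact_mod_cast ht.2) hST)
  set K := Icc (-(2 * R)) (2 * R) with hK
  set C := q * M ^ (q - 2) * M with hC
  have hum : AEStronglyMeasurable (fun x => u x 0) volume :=
    hu₀.congr (hu.initial.mono fun x hx => hx.symm)
  refine tendsto_integral_of_L1' _ ?_ ?_ ?_
  · exact (((continuous_abs.rpow_const fun _ => Or.inr (by linarith)).comp_aestronglyMeasurable
      hum).mul (hη.contDiff.continuous.pow 2).aestronglyMeasurable)
  · filter_upwards [hpos] with t ht
    exact hη.integrable (by linarith) (hcont t ht)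
  · have h1 : Tendsto (fun t : ℝ => ‖C‖ₑ * eLpNorm (fun x => u x t - u₀ x) 1 (volume.restrict K))
        (𝓝[>] 0) (𝓝 0) := by
      have := ENNReal.Tendsto.const_mul (a := ‖C‖ₑ) (hu.tendsto_initial K isCompact_Icc)
        (Or.inr enorm_ne_top)
      rwa [mul_zero] at this
    refine tendsto_of_tendsto_of_tendsto_of_le_of_le' tendsto_const_nhds h1
      (Eventually.of_forall fun _ => zero_le) ?_
    filter_upwards [hpos] with t ht
    rw [← eLpNorm_const_smul, ← eLpNorm_indicator_eq_eLpNorm_restrict measurableSet_Icc]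
    refine eLpNorm_mono_ae ?_
    filter_upwards [hM t ⟨ht.1.le, ht.2⟩, hM 0 ⟨le_rfl, hS.le⟩, hu.initial] with x h1 h2 h3
    by_cases hx : x ∈ K
    · rw [indicator_of_mem hx]
      simp only [Pi.sub_apply, Pi.smul_apply, smul_eq_mul, Real.norm_eq_abs]
      rw [← sub_mul, abs_mul, abs_of_nonneg (sq_nonneg (η x)), ← h3]
      refine (mul_le_of_le_one_right (abs_nonneg _) (hη.sq_le_one x)).trans ?_
      refine (abs_abs_rpow_sub_abs_rpow_le hq h1 h2).trans ?_
      rw [abs_mul]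
      exact mul_le_mul_of_nonneg_right (le_abs_self _) (abs_nonneg _)
    · simp [hη.eq_zero hx]

theorem IsSolution.continuousOn_cutoffEnergy (hu : IsSolution b u₀ T u)
    (hu₀ : AEStronglyMeasurable u₀ volume) {q : ℝ} (hq : 2 ≤ q) {η : ℝ → ℝ} {R ε : ℝ}
    (hη : IsCutoff η R ε) {a t : ℝ} (ha : 0 ≤ a) (hat : a < t) (htT : (t : EReal) < T) :
    ContinuousOn (cutoffEnergy u q η) (Icc a t) := by
  intro τ hτ
  rcases (ha.trans hτ.1).eq_or_lt with h | h
  · have := hu.tendsto_cutoffEnergy_zero hu₀ hq hη (ha.trans_lt hat) htT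
    have h0 : ContinuousWithinAt (cutoffEnergy u q η) (Ioi 0) 0 := this
    rw [continuousWithinAt_Ioi_iff_Ici] at h0
    rw [← h]
    exact h0.mono fun x hx => ha.trans hx.1
  · exact (hu.regular.hasDerivAt_cutoffEnergy hq hη.contDiff.continuous hη.tsupport_subset h
      (lt_of_le_of_lt (by exact_mod_cast hτ.2) htT)).continuousAt.continuousWithinAt

/-- If `b` does not depend on `x` for times in `[a, t]`, then the localized energies grow at most at a rate governed
by the mass of `|u|^q` on the support of the cutoff. -/
theorem IsSolution.exists_cutoffEnergy_le_add (hu : IsSolution b u₀ T u)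
    (hb : IsAdvectionField b) (hu₀ : AEStronglyMeasurable u₀ volume) {q : ℝ} (hq : 2 ≤ q) {a t : ℝ}
    (ha : 0 ≤ a) (htT : (t : EReal) < T) (hosc : ∀ s ∈ Icc a t, halfOsc b s ≤ 0) :
    ∃ K R₀ : ℝ, 0 ≤ K ∧ 1 ≤ R₀ ∧ ∀ R ≥ R₀, ∀ D : ℝ,
      (∀ s ∈ Ioo a t, ∫ x in Icc (-(2 * R)) (2 * R), |u x s| ^ q ≤ D) → ∀ τ ∈ Ioc a t,
      ∃ η ε, IsCutoff η R ε ∧ ENNReal.ofReal (cutoffEnergy u q η τ) ≤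
        (∫⁻ x, ‖u x a‖ₑ ^ q) + ENNReal.ofReal (K * D / R) := by
  obtain ⟨M, hM⟩ := hb.bounded
  obtain ⟨L, hL, hcut⟩ := exists_isCutoff
  have hM0 : 0 ≤ M := (abs_nonneg _).trans (hM 0 0 le_rfl)
  have hKn : 0 ≤ 8 + 4 * q * M := by positivity
  refine ⟨(8 + 4 * q * M) * L * |t - a|, max 1 L, by positivity, le_max_left _ _,
    fun R hR D hD τ hτ => ?_⟩
  have hR1 : 1 ≤ R := (le_max_left _ _).trans hR
  have hR0 : 0 < R := zero_lt_one.trans_le hR1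
  have hτT : (τ : EReal) < T := lt_of_le_of_lt (by exact_mod_cast hτ.2) htT
  obtain ⟨η, hη⟩ := hcut R hR1
  refine ⟨η, _, hη, ?_⟩
  have hD0 : 0 ≤ D := by
    obtain ⟨s, hs⟩ := exists_between (hτ.1.trans_le hτ.2)
    exact (integral_nonneg fun x => Real.rpow_nonneg (abs_nonneg _) _).trans (hD s hs)
  have hlin := le_add_mul_of_deriv_le (C := (8 + 4 * q * M) * (L / R) * D) hτ.1.le
    (hu.continuousOn_cutoffEnergy hu₀ hq hη ha hτ.1 hτT) fun s hs => ?_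
  · refine (ENNReal.ofReal_le_ofReal hlin).trans (ENNReal.ofReal_add_le.trans ?_)
    refine add_le_add (hη.ofReal_cutoffEnergy_le (by linarith) u a) (ENNReal.ofReal_le_ofReal ?_)
    have h1 : τ - a ≤ |t - a| := (sub_le_sub_right hτ.2 a).trans (le_abs_self _)
    have h2 := mul_le_mul_of_nonneg_left h1
      (show 0 ≤ (8 + 4 * q * M) * (L / R) * D by positivity)
    refine h2.trans (le_of_eq ?_)
    ring
  · have hs0 : 0 < s := ha.trans_lt hs.1
    have hst : s < t := hs.2.trans_le hτ.2
    obtain ⟨E', J, hE', hJ, -, hle⟩ := hu.exists_energy_inequality hb hq hη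
      (div_le_one_of_le₀ ((le_max_right _ _).trans hR) hR0.le) (fun x => hM x s hs0.le)
      (hosc s ⟨hs.1.le, hst.le⟩) hM0 hs0 (lt_trans (by exact_mod_cast hst) htT)
    refine ⟨E', hE', hle.trans ?_⟩
    have h1 : 0 ≤ 2 * (q - 1) / q * J :=
      mul_nonneg (div_nonneg (by linarith) (by linarith)) hJ
    have h2 := mul_le_mul_of_nonneg_left (hD s ⟨hs.1, hst⟩)
      (show 0 ≤ (8 + 4 * q * M) * (L / R) by positivity)
    simp only [mul_zero, zero_div, ne_eq, OfNat.ofNat_ne_zero, not_false_eq_true, zero_pow,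
      zero_mul, sub_zero]
    linarith

/-- If `b` does not depend on `x`, then `‖u(·,t)‖_q` does not increase. -/
theorem IsSolution.lintegral_le_of_halfOsc_nonpos (hu : IsSolution b u₀ T u)
    (hb : IsAdvectionField b) (hu₀ : AEStronglyMeasurable u₀ volume) {q : ℝ} (hq : 2 ≤ q) {a t : ℝ}
    (ha : 0 ≤ a) (hat : a < t) (htT : (t : EReal) < T)
    (hosc : ∀ s ∈ Icc a t, halfOsc b s ≤ 0) :
    ∫⁻ x, ‖u x t‖ₑ ^ q ≤ ∫⁻ x, ‖u x a‖ₑ ^ q := by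
  rcases eq_or_ne (∫⁻ x, ‖u x a‖ₑ ^ q) ∞ with hinf | hfin
  · rw [hinf]; exact le_top
  have hq0 : 0 ≤ q := by linarith
  have hT : ∀ s ∈ Ioc a t, (s : EReal) < T := fun s hs =>
    lt_of_le_of_lt (by exact_mod_cast hs.2) htT
  obtain ⟨A, hA⟩ := hu.bounded t (ha.trans_lt hat) htT
  have hA' : ∀ s ∈ Ioc a t, ∀ x, |u x s| ≤ A := fun s hs =>
    hu.abs_le_of_pos (ha.trans_lt hs.1) (hT s hs) (hA s ⟨(ha.trans_lt hs.1).le, hs.2⟩)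
  have hcont : ∀ s ∈ Ioc a t, Continuous fun x => u x s := fun s hs =>
    hu.regular.continuous_space (ha.trans_lt hs.1) (hT s hs)
  obtain ⟨K, R₀, hK, hR₀, hmain⟩ := hu.exists_cutoffEnergy_le_add hb hu₀ hq ha htT hosc
  -- Bootstrap: the crude mass bound `4 R A^q` on `[-2R, 2R]` cancels the `1/R` of the cutoff error,
  -- which gives a bound `C` uniform in time.
  set C := (∫⁻ x, ‖u x a‖ₑ ^ q) + ENNReal.ofReal (K * (4 * A ^ q)) with hC
  have hCfin : C ≠ ∞ := ENNReal.add_ne_top.2 ⟨hfin, ENNReal.ofReal_ne_top⟩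
  have hunif : ∀ s ∈ Ioc a t, ∫⁻ x, ‖u x s‖ₑ ^ q ≤ C := by
    intro s hs
    refine lintegral_le_of_eventually_cutoffEnergy_le hq0 (hcont s hs) ?_
    filter_upwards [eventually_ge_atTop R₀] with R hR
    have hR0 : 0 < R := by linarith
    have hmass : ∀ σ ∈ Ioo a t, ∫ x in Icc (-(2 * R)) (2 * R), |u x σ| ^ q ≤ 4 * R * A ^ q := by
      intro σ hσ
      have h1 : ∀ x ∈ Icc (-(2 * R)) (2 * R), |u x σ| ^ q ≤ A ^ q := fun x _ =>
        Real.rpow_le_rpow (abs_nonneg _) (hA' σ ⟨hσ.1, hσ.2.le⟩ x) hq0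
      refine (setIntegral_mono_on (((hcont σ ⟨hσ.1, hσ.2.le⟩).abs.rpow_const
        fun _ => Or.inr hq0).integrableOn_Icc) continuous_const.integrableOn_Icc
        measurableSet_Icc h1).trans (le_of_eq ?_)
      rw [setIntegral_const, Real.volume_real_Icc_of_le (by linarith), smul_eq_mul]
      ring
    obtain ⟨η, ε, hη, h⟩ := hmain R hR (4 * R * A ^ q) hmass s hs
    refine ⟨η, ε, hη, h.trans (le_of_eq ?_)⟩
    rw [hC]
    congr 2
    field_simp
  refine ENNReal.le_of_forall_pos_le_add fun δ hδ _ => ?_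
  refine lintegral_le_of_eventually_cutoffEnergy_le hq0 (hcont t ⟨hat, le_rfl⟩) ?_
  -- With the mass now bounded by `C` independently of `R`, the same estimate has an error that
  -- tends to zero.
  have hmass : ∀ R : ℝ, ∀ σ ∈ Ioo a t, ∫ x in Icc (-(2 * R)) (2 * R), |u x σ| ^ q ≤ C.toReal := by
    intro R σ hσ
    rw [← ENNReal.ofReal_le_iff_le_toReal hCfin]
    refine (ofReal_integral_le_lintegral_rpow hq0 (v := fun x => u x σ) fun x => ?_).trans
      ((setLIntegral_le_lintegral _ _).trans (hunif σ ⟨hσ.1, hσ.2.le⟩))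
    rw [abs_of_nonneg (Real.rpow_nonneg (abs_nonneg _) _)]
  have hlim : Tendsto (fun R : ℝ => K * C.toReal / R) atTop (𝓝 0) :=
    tendsto_const_nhds.div_atTop tendsto_id
  filter_upwards [eventually_ge_atTop R₀, hlim.eventually_le_const (NNReal.coe_pos.2 hδ)]
    with R hR hRδ
  obtain ⟨η, ε, hη, h⟩ := hmain R hR C.toReal (hmass R) t ⟨hat, le_rfl⟩
  refine ⟨η, ε, hη, h.trans (add_le_add le_rfl ?_)⟩
  exact ENNReal.ofReal_le_of_le_toReal (by simpa using hRδ)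

theorem nashConst_pos : 0 < nashConst := by
  unfold nashConst
  positivity

theorem nashConst_pow_three : nashConst ^ 3 = 3 * √3 / (4 * π) := by
  rw [nashConst, ← Real.rpow_natCast, ← Real.rpow_mul (by positivity)]
  norm_num

theorem nashConst_pow_three_sq : (nashConst ^ 3) ^ 2 = 27 / (16 * π ^ 2) := by
  rw [nashConst_pow_three, div_pow, mul_pow, mul_pow, Real.sq_sqrt (by norm_num)]
  norm_num

/-- With threshold `l = β κ N²`, multiplying by `κ² N⁴` turns the right side into at least `E (E² -
l²)`, and `E ≥ l + δ` makes both factors large. The strictly positive gain is what absorbs the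
cutoff error. -/
theorem dissipation_lower_bound {E J N β κ δ : ℝ} (hN : 0 < N) (hκ : 0 < κ) (hβ : 0 ≤ β)
    (hδ : 0 < δ) (hE : β * κ * N ^ 2 + δ ≤ E) (hJ : E ^ 3 ≤ κ ^ 2 * N ^ 4 * J) :
    δ ^ 3 / (κ ^ 2 * N ^ 4) ≤ J - β ^ 2 * E := by
  rw [div_le_iff₀ (by positivity)]
  set l := β * κ * N ^ 2 with hl
  have hl0 : 0 ≤ l := by positivity
  have h1 : δ ^ 2 ≤ E ^ 2 - l ^ 2 := by nlinarith
  have h2 : δ ^ 3 ≤ E * (E ^ 2 - l ^ 2) := by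
    calc δ ^ 3 = δ * δ ^ 2 := by ring
      _ ≤ E * (E ^ 2 - l ^ 2) := mul_le_mul (by linarith) h1 (by positivity) (by linarith)
  have h3 : (J - β ^ 2 * E) * (κ ^ 2 * N ^ 4) = κ ^ 2 * N ^ 4 * J - E * l ^ 2 := by
    rw [hl]; ring
  linarith

/-- The decay of the energy above the threshold given by the Nash inequality. -/
theorem IsSolution.lintegral_le_max (hu : IsSolution b u₀ T u)
    (hb : IsAdvectionField b) (hu₀ : AEStronglyMeasurable u₀ volume) {q : ℝ} (hq : 2 ≤ q)
    {a t : ℝ} (ha : 0 ≤ a) (hat : a < t) (htT : (t : EReal) < T) {B N : ℝ} (hB0 : 0 ≤ B)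
    (hosc : ∀ s ∈ Icc a t, halfOsc b s ≤ B) (hN0 : 0 < N)
    (hN : ∀ s ∈ Icc a t, ∫⁻ x, ‖u x s‖ₑ ^ (q / 2) ≤ ENNReal.ofReal N) :
    ∫⁻ x, ‖u x t‖ₑ ^ q ≤
      max (∫⁻ x, ‖u x a‖ₑ ^ q) (ENNReal.ofReal (q / 2 * nashConst ^ 3 * B * N ^ 2)) := by
  have hq0 : 0 ≤ q := by linarith
  have hT : ∀ s ∈ Ioc a t, (s : EReal) < T := fun s hs =>
    lt_of_le_of_lt (by exact_mod_cast hs.2) htT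
  obtain ⟨A, hA⟩ := hu.bounded t (ha.trans_lt hat) htT
  have hA' : ∀ s ∈ Ioc a t, ∀ x, |u x s| ≤ A := fun s hs =>
    hu.abs_le_of_pos (ha.trans_lt hs.1) (hT s hs) (hA s ⟨(ha.trans_lt hs.1).le, hs.2⟩)
  have hA0 : 0 ≤ A := (abs_nonneg _).trans (hA' t ⟨hat, le_rfl⟩ 0)
  have hcont : ∀ s ∈ Ioc a t, Continuous fun x => u x s := fun s hs =>
    hu.regular.continuous_space (ha.trans_lt hs.1) (hT s hs)
  obtain ⟨M₀, hM₀⟩ := hb.bounded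
  set M := max M₀ B
  have hM : ∀ x s : ℝ, 0 ≤ s → |b x s| ≤ M := fun x s hs => (hM₀ x s hs).trans (le_max_left _ _)
  have hBM : B ≤ M := le_max_right _ _
  have hM0 : 0 ≤ M := hB0.trans hBM
  obtain ⟨L, hL, hcut⟩ := exists_isCutoff
  -- `|u|^q ≤ A^(q/2) |u|^(q/2)` bounds the mass on every interval independently of its length.
  set D := A ^ (q / 2) * N with hD
  have hDle : ∀ s ∈ Ioc a t, ∀ ρ : ℝ, ∫ x in Icc (-ρ) ρ, |u x s| ^ q ≤ D := by
    intro s hs ρ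
    have hD0 : 0 ≤ D := mul_nonneg (Real.rpow_nonneg hA0 _) hN0.le
    rw [← ENNReal.ofReal_le_ofReal_iff hD0]
    refine (ofReal_integral_le_lintegral_rpow hq0 (v := fun x => u x s) fun x => ?_).trans
      ((setLIntegral_le_lintegral _ _).trans ?_)
    · rw [abs_of_nonneg (Real.rpow_nonneg (abs_nonneg _) _)]
    · rw [hD, ENNReal.ofReal_mul (Real.rpow_nonneg hA0 _)]
      refine le_trans ?_ (mul_le_mul_right (hN s ⟨hs.1.le, hs.2⟩) _)
      rw [← lintegral_const_mul' _ _ ENNReal.ofReal_ne_top]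
      refine lintegral_mono fun x => ?_
      rw [enorm_rpow_eq_ofReal hq0, enorm_rpow_eq_ofReal (by linarith),
        ← ENNReal.ofReal_mul (Real.rpow_nonneg hA0 _)]
      refine ENNReal.ofReal_le_ofReal ?_
      have h1 : |u x s| ^ q = |u x s| ^ (q / 2) * |u x s| ^ (q / 2) := by
        rw [← Real.rpow_add_of_nonneg (abs_nonneg _) (by linarith) (by linarith), add_halves]
      rw [h1]
      exact mul_le_mul_of_nonneg_right
        (Real.rpow_le_rpow (abs_nonneg _) (hA' s hs x) (by linarith))
        (Real.rpow_nonneg (abs_nonneg _) _)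
  set l := q / 2 * nashConst ^ 3 * B * N ^ 2 with hl
  have hκ : 0 < nashConst ^ 3 := pow_pos nashConst_pos 3
  refine ENNReal.le_of_forall_pos_le_add fun δ hδ _ => ?_
  have hδ' : (0 : ℝ) < δ := NNReal.coe_pos.2 hδ
  refine lintegral_le_of_eventually_cutoffEnergy_le hq0 (hcont t ⟨hat, le_rfl⟩) ?_
  -- `c` is the rate of decay guaranteed at height `δ` above the threshold; `R` is taken so large
  -- that the cutoff error is at most `c`.
  set c := 2 * (q - 1) / q * ((δ : ℝ) ^ 3 / ((nashConst ^ 3) ^ 2 * N ^ 4)) with hc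
  have hc0 : 0 < c := mul_pos (div_pos (by linarith) (by linarith)) (by positivity)
  have hlim : Tendsto (fun R : ℝ => (8 + 4 * q * M) * L * D / R) atTop (𝓝 0) :=
    tendsto_const_nhds.div_atTop tendsto_id
  filter_upwards [eventually_ge_atTop (max 1 L), hlim.eventually_le_const hc0] with R hR hRc
  have hR1 : 1 ≤ R := (le_max_left _ _).trans hR
  have hR0 : 0 < R := zero_lt_one.trans_le hR1
  obtain ⟨η, hη⟩ := hcut R hR1
  refine ⟨η, _, hη, ?_⟩
  have hmax := le_max_of_deriv_nonpos (L := l + δ) hat.le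
    (hu.continuousOn_cutoffEnergy hu₀ hq hη ha hat htT) fun s hs => ?_
  · refine (ENNReal.ofReal_le_ofReal hmax).trans ?_
    rw [ENNReal.ofReal_max]
    refine max_le ?_ ?_
    · exact (hη.ofReal_cutoffEnergy_le hq0 u a).trans ((le_max_left _ _).trans le_self_add)
    · refine ENNReal.ofReal_add_le.trans (add_le_add (le_max_right _ _) ?_)
      rw [ENNReal.ofReal_coe_nnreal]
  · have hs0 : 0 < s := ha.trans_lt hs.1
    obtain ⟨E', J, hE', hJ, hnash, hle⟩ := hu.exists_energy_inequality hb hq hη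
      (div_le_one_of_le₀ ((le_max_right _ _).trans hR) hR0.le) (fun x => hM x s hs0.le)
      (hosc s ⟨hs.1.le, hs.2.le⟩) hBM hs0 (hT s ⟨hs.1, hs.2.le⟩)
    refine ⟨E', hE', fun hlt => hle.trans ?_⟩
    have hI0 : 0 ≤ ∫ x, |u x s| ^ (q / 2) * η x := integral_nonneg fun x =>
      mul_nonneg (Real.rpow_nonneg (abs_nonneg _) _) (hη.nonneg x)
    have hIN : ∫ x, |u x s| ^ (q / 2) * η x ≤ N := by
      rw [← ENNReal.ofReal_le_ofReal_iff hN0.le]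
      refine (ofReal_integral_le_lintegral_rpow (by linarith) (v := fun x => u x s)
        fun x => ?_).trans (hN s ⟨hs.1.le, hs.2.le⟩)
      have h := Real.rpow_nonneg (abs_nonneg (u x s)) (q / 2)
      rw [abs_of_nonneg (mul_nonneg h (hη.nonneg x))]
      exact mul_le_of_le_one_right h (hη.le_one x)
    rw [← nashConst_pow_three_sq] at hnash
    have hnash' : cutoffEnergy u q η s ^ 3 ≤ (nashConst ^ 3) ^ 2 * N ^ 4 * J := by
      refine hnash.trans ?_
      gcongr
    have hlow := dissipation_lower_bound (β := q * B / 2) hN0 hκ (by positivity) hδ'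
      (le_of_eq_of_le (by rw [hl]; ring) hlt.le) hnash'
    have h1 := mul_le_mul_of_nonneg_left hlow
      (show 0 ≤ 2 * (q - 1) / q from div_nonneg (by linarith) hq0)
    have h2 := mul_le_mul_of_nonneg_left (hDle s ⟨hs.1, hs.2.le⟩ (2 * R))
      (show 0 ≤ (8 + 4 * q * M) * (L / R) by positivity)
    have h3 : (8 + 4 * q * M) * (L / R) * D = (8 + 4 * q * M) * L * D / R := by ring
    linarith

/-! ### From integrals to norms, and the degenerate cases. -/

theorem normAt_eq {q : ℝ} (hq : 0 < q) (u : ℝ → ℝ → ℝ) (t : ℝ) :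
    normAt u q t = (∫⁻ x, ‖u x t‖ₑ ^ q) ^ (1 / q) := by
  rw [normAt, eLpNorm_eq_lintegral_rpow_enorm_toReal (by simpa using hq) ENNReal.ofReal_ne_top,
    ENNReal.toReal_ofReal hq.le]

theorem normAt_rpow {q : ℝ} (hq : 0 < q) (u : ℝ → ℝ → ℝ) (t : ℝ) :
    normAt u q t ^ q = ∫⁻ x, ‖u x t‖ₑ ^ q := by
  rw [normAt_eq hq, ← ENNReal.rpow_mul, one_div_mul_cancel hq.ne', ENNReal.rpow_one]

theorem ofReal_halfOsc_le_supOsc {t₀ t s : ℝ} (hs : s ∈ Icc t₀ t) :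
    ENNReal.ofReal (halfOsc b s) ≤ supOsc b t₀ t :=
  le_iSup₂ (f := fun τ (_ : τ ∈ Icc t₀ t) => ENNReal.ofReal (halfOsc b τ)) s hs

theorem IsAdvectionField.supOsc_ne_top (hb : IsAdvectionField b) {t₀ : ℝ} (t : ℝ) (ht₀ : 0 ≤ t₀) :
    supOsc b t₀ t ≠ ∞ := by
  obtain ⟨M, hM⟩ := hb.bounded
  refine ne_top_of_le_ne_top (ENNReal.ofReal_ne_top (r := M)) (iSup₂_le fun s hs => ?_)
  exact ENNReal.ofReal_le_ofReal (halfOsc_le fun x => hM x s (ht₀.trans hs.1))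

theorem IsSolution.normAt_le_max (hu : IsSolution b u₀ T u) (hb : IsAdvectionField b)
    (hu₀ : AEStronglyMeasurable u₀ volume) {q : ℝ} (hq : 2 ≤ q) {t₀ t τ : ℝ} (ht₀ : 0 ≤ t₀)
    (hτ : τ ∈ Ioc t₀ t) (htT : (t : EReal) < T) :
    normAt u q τ ≤ max (normAt u q t₀)
      (ENNReal.ofReal (q / 2 * nashConst ^ 3) ^ (1 / q) * supOsc b t₀ t ^ (1 / q)
        * supNorm u (q / 2) t₀ t) := by
  have hq0 : 0 < q := by linarith
  have hq1 : 0 < 1 / q := by positivity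
  have hτT : (τ : EReal) < T := lt_of_le_of_lt (by exact_mod_cast hτ.2) htT
  have hsub : ∀ s ∈ Icc t₀ τ, s ∈ Icc t₀ t := fun s hs => ⟨hs.1, hs.2.trans hτ.2⟩
  have hBfin := hb.supOsc_ne_top t ht₀
  have hκ : 0 < q / 2 * nashConst ^ 3 := by
    have := pow_pos nashConst_pos 3
    positivity
  have hU : ∀ s ∈ Icc t₀ t, normAt u (q / 2) s ≤ supNorm u (q / 2) t₀ t := fun s hs =>
    le_iSup₂ (f := fun τ (_ : τ ∈ Icc t₀ t) => normAt u (q / 2) τ) s hs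
  rcases eq_or_ne (supOsc b t₀ t) 0 with hB | hB
  -- Here the second entry of the maximum is `0`, even if the `L^(q/2)` supremum is infinite, so the
  -- bound must come from the initial norm alone.
  · refine le_max_of_le_left ?_
    rw [normAt_eq hq0, normAt_eq hq0]
    refine ENNReal.rpow_le_rpow (hu.lintegral_le_of_halfOsc_nonpos hb hu₀ hq ht₀ hτ.1 hτT
      fun s hs => ?_) hq1.le
    have := ofReal_halfOsc_le_supOsc (b := b) (hsub s hs)
    rw [hB] at this
    exact ENNReal.ofReal_eq_zero.1 (nonpos_iff_eq_zero.1 this)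
  rcases eq_or_ne (supNorm u (q / 2) t₀ t) ∞ with hUt | hUt
  · refine le_max_of_le_right ?_
    rw [hUt, ENNReal.mul_top]
    · exact le_top
    · refine mul_ne_zero (fun h => ?_) fun h => ?_
      · rcases ENNReal.rpow_eq_zero_iff.1 h with h | h
        · exact (ENNReal.ofReal_pos.2 hκ).ne' h.1
        · linarith [h.2]
      · rcases ENNReal.rpow_eq_zero_iff.1 h with h | h
        · exact hB h.1
        · linarith [h.2]
  have hN : ∀ s ∈ Icc t₀ t, ∫⁻ x, ‖u x s‖ₑ ^ (q / 2) ≤ supNorm u (q / 2) t₀ t ^ (q / 2) := by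
    intro s hs
    rw [← normAt_rpow (half_pos hq0)]
    exact ENNReal.rpow_le_rpow (hU s hs) (half_pos hq0).le
  have hNfin : supNorm u (q / 2) t₀ t ^ (q / 2) ≠ ∞ :=
    ENNReal.rpow_ne_top_of_nonneg (half_pos hq0).le hUt
  -- The decay estimate divides by `N`, so `N = 0` is treated apart; there the solution vanishes
  -- almost everywhere.
  rcases eq_or_ne (supNorm u (q / 2) t₀ t) 0 with hU0 | hU0
  · have h0 : normAt u (q / 2) τ = 0 := by
      have := hU τ ⟨hτ.1.le, hτ.2⟩
      rwa [hU0, nonpos_iff_eq_zero] at this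
    have hm := (hu.regular.continuous_space (ht₀.trans_lt hτ.1) hτT).aestronglyMeasurable
      (μ := volume)
    have hz := (eLpNorm_eq_zero_iff hm (by simpa using hq0)).1 h0
    have : normAt u q τ = 0 := (eLpNorm_eq_zero_iff hm (by simpa using hq0)).2 hz
    rw [this]
    exact zero_le
  have hNpos : 0 < (supNorm u (q / 2) t₀ t ^ (q / 2)).toReal :=
    ENNReal.toReal_pos (fun h => hU0 ((ENNReal.rpow_eq_zero_iff_of_pos (half_pos hq0)).1 h)) hNfin
  have hmain := hu.lintegral_le_max hb hu₀ hq ht₀ hτ.1 hτT (B := (supOsc b t₀ t).toReal)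
    ENNReal.toReal_nonneg (fun s hs => (ENNReal.ofReal_le_iff_le_toReal hBfin).1
      (ofReal_halfOsc_le_supOsc (hsub s hs))) hNpos
    fun s hs => by rw [ENNReal.ofReal_toReal hNfin]; exact hN s (hsub s hs)
  have hmain' := ENNReal.rpow_le_rpow hmain hq1.le
  rw [(ENNReal.monotone_rpow_of_nonneg hq1.le).map_max, ← normAt_eq hq0, ← normAt_eq hq0] at hmain'
  refine hmain'.trans (max_le_max le_rfl (le_of_eq ?_))
  rw [ENNReal.ofReal_mul (by positivity), ENNReal.ofReal_mul hκ.le, ENNReal.ofReal_toReal hBfin,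
    ENNReal.ofReal_pow hNpos.le, ENNReal.ofReal_toReal hNfin,
    ENNReal.mul_rpow_of_nonneg _ _ hq1.le, ENNReal.mul_rpow_of_nonneg _ _ hq1.le]
  congr 1
  rw [← ENNReal.rpow_natCast, ← ENNReal.rpow_mul, ← ENNReal.rpow_mul]
  -- The scaling closes up: `N` is the supremum norm to the power `q / 2`, so `(N²)^(1/q)` is that
  -- norm itself.
  have : q / 2 * ((2 : ℕ) : ℝ) * (1 / q) = 1 := by
    push_cast
    field_simp
  rw [← mul_assoc, this, ENNReal.rpow_one]

end AdvDiff

theorem theorem2p3 (b : ℝ → ℝ → ℝ) (hb : AdvDiff.IsAdvectionField b)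
    (p₀ : ℝ) (hp₀ : 1 ≤ p₀)
    (u₀ : ℝ → ℝ) (hu₀ : MemLp u₀ (ENNReal.ofReal p₀) volume) (hu₀' : MemLp u₀ ∞ volume)
    (T : EReal) (hT : 0 < T)
    (u : ℝ → ℝ → ℝ) (hu : AdvDiff.IsSolution b u₀ T u)
    (q : ℝ) (hq : 2 * p₀ ≤ q)
    (t₀ t : ℝ) (ht₀ : 0 ≤ t₀) (ht₀t : t₀ ≤ t) (htT : (t : EReal) < T) :
    AdvDiff.supNorm u q t₀ t ≤
      max (AdvDiff.normAt u q t₀)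
        (ENNReal.ofReal (q / 2 * AdvDiff.nashConst ^ 3) ^ (1 / q)
          * AdvDiff.supOsc b t₀ t ^ (1 / q)
          * AdvDiff.supNorm u (q / 2) t₀ t) := by
  refine iSup₂_le fun τ hτ => ?_
  rcases hτ.1.eq_or_lt with rfl | hlt
  · exact le_max_left _ _
  · exact hu.normAt_le_max hb hu₀.aestronglyMeasurable (by linarith) ht₀ ⟨hlt, hτ.2⟩ htT
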